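/- **Setting.** Fix an infinite set $\Sigma$ of labels. A tree is a finite, ordered, unranked tree in which every vertex has a label from $\Sigma$. The expressions of $\mathrm{XP}(/,/\!/,[\,],*,|)$ are the location paths generated by the grammar $$p ::= s \;\big|\; p/p \;\big|\; (p \mid p),\qquad s ::= a :: \nu\,[e]\cdots[e],\qquad e ::= p \;\big|\; p \text{ or } p,$$ with axes $a\in\{\text{self},\text{child},\text{descendant}\}$ and node tests $\nu\in\Sigma\cup\{*\}$. On every tree $t$ a location path $p$ defines a binary relation $[\![p]\!]_t$ on the vertices of $t$: - $(u,v)\in[\![a::\nu[e_1]\cdots[e_k]]\!]_t$ iff $v$ is reached from $u$ along the axis $a$ (that is, $v=u$, $v$ is a child of $u$, or $v$ is a proper descendant of $u$), $\nu=*$ or the label of $v$ is $\nu$, and each $e_i$ is true at $v$. A path $p$ is true at $v$ iff $(v,w)\in[\![p]\!]_t$ for some $w$, and "$p$ or $p'$" is true at $v$ iff $p$ or $p'$ is. - $p/p'$ denotes the composition, and $p\mid p'$ the union, of the two relations. Write $t\models p$ if $(\text{root},v)\in[\![p]\!]_t$ for some vertex $v$, and $p\subseteq q$ if $t\models p$ implies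 $t\models q$ for every tree $t$. The size of an expression is the number of occurrences of the axes child and descendant in it, including those inside filters. The disjuncts of $p$ are the disjunction-free expressions obtained by choosing one alternative at every occurrence of $\mid$ and "or" in $p$. **Theorem 3.1.** 1. The containment problem for $\mathrm{XP}(/,/\!/,[\,],*,|)$ (given $p$ and $q$, written as words over a finite alphabet, with the words over $\{0,1\}$ as the infinite set of labels; is $p\subseteq q$?) is in coNP. 2. Let $\Sigma$ be any infinite set of labels, let $p,q$ be expressions over $\Sigma$, and let $n\ge 1$ and $m\ge 0$ be integers such that every disjunct of $p$ has size at most $n$ and every disjunct of $q$ has size at most $m$. Then there is a label that occurs neither in $p$ nor in $q$, and for every such label $\#$, $p\not\subseteq q$ if and only if there is a tree $t$ with at most $2n(m+2)$ nodes, all of whose labels occur in $p$ or are equal to $\#$, such that $t\models p$ and $t\not\models q$. -/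

import Mathlib

namespace XPathContainment

universe u

/-- A finite, ordered, unranked tree with labels in `S`.  Its vertices form a tree domain: a vertex
is the sequence of child numbers on the path from the root, which is the empty sequence.  Children
are numbered from `0` here.  Only the values of `lab` on `dom` matter. -/
structure XMLTree (S : Type u) where
  dom : Finset (List ℕ)
  root_mem : [] ∈ dom
  parent_mem : ∀ (v : List ℕ) (i : ℕ), v ++ [i] ∈ dom → v ∈ dom
  sibling_mem : ∀ (v : List ℕ) (i : ℕ), v ++ [i + 1] ∈ dom → v ++ [i] ∈ dom
  lab : List ℕ → S

inductive Axis
  | self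
  | child
  | descendant

inductive NodeTest (S : Type u)
  | wildcard
  | label (a : S)

mutual

/-- Location paths: a location step, a composition `p / q`, or a disjunction `p | q`. -/
inductive LPath (S : Type u)
  | step (s : LStep S)
  | seq (p q : LPath S)
  | union (p q : LPath S)

/-- Location steps `axis :: test [e₁] ⋯ [eₖ]`; `filter s e` appends the filter `[e]` to `s`. -/
inductive LStep (S : Type u)
  | base (a : Axis) (n : NodeTest S)
  | filter (s : LStep S) (e : FExpr S)

/-- Filter expressions: a location path, or `p or q` for two location paths. -/
inductive FExpr (S : Type u)
  | path (p : LPath S)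
  | or (p q : LPath S)

end

variable {S : Type u}

/-- `a.Rel u v`: the vertex `v` is reached from the vertex `u` along the axis `a`. -/
def Axis.Rel : Axis → List ℕ → List ℕ → Prop
  | .self, u, v => v = u
  | .child, u, v => ∃ i : ℕ, v = u ++ [i]
  | .descendant, u, v => ∃ w : List ℕ, w ≠ [] ∧ v = u ++ w

def NodeTest.Holds : NodeTest S → S → Prop
  | .wildcard, _ => True
  | .label a, b => b = a

mutual

/-- The binary relation on the vertices of `t` that a location path defines. -/
def LPath.Sem (t : XMLTree S) : LPath S → List ℕ → List ℕ → Prop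
  | .step s, u, v => s.Sem t u v
  | .seq p q, u, v => ∃ w, p.Sem t u w ∧ q.Sem t w v
  | .union p q, u, v => p.Sem t u v ∨ q.Sem t u v

/-- The binary relation on the vertices of `t` that a location step defines. -/
def LStep.Sem (t : XMLTree S) : LStep S → List ℕ → List ℕ → Prop
  | .base a n, u, v => u ∈ t.dom ∧ v ∈ t.dom ∧ a.Rel u v ∧ n.Holds (t.lab v)
  | .filter s e, u, v => s.Sem t u v ∧ e.Holds t v

/-- The truth value of a filter expression at a vertex of `t`. -/
def FExpr.Holds (t : XMLTree S) : FExpr S → List ℕ → Prop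
  | .path p, v => ∃ w, p.Sem t v w
  | .or p q, v => (∃ w, p.Sem t v w) ∨ (∃ w, q.Sem t v w)

end

/-- `t ⊨ p`: the expression selects some vertex when it is evaluated at the root. -/
def XMLTree.Matches (t : XMLTree S) (p : LPath S) : Prop := ∃ v, p.Sem t [] v

/-- Boolean containment. -/
def LPath.Contained (p q : LPath S) : Prop := ∀ t : XMLTree S, t.Matches p → t.Matches q

def NodeTest.labels : NodeTest S → Set S
  | .wildcard => ∅
  | .label a => {a}

/- The set of labels that occur in an expression. -/
mutual

def LPath.labels : LPath S → Set S
  | .step s => s.labels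
  | .seq p q => p.labels ∪ q.labels
  | .union p q => p.labels ∪ q.labels

def LStep.labels : LStep S → Set S
  | .base _ n => n.labels
  | .filter s e => s.labels ∪ e.labels

def FExpr.labels : FExpr S → Set S
  | .path p => p.labels
  | .or p q => p.labels ∪ q.labels

end

def Axis.size : Axis → ℕ
  | .self => 0
  | .child => 1
  | .descendant => 1

/- The size of an expression: the number of occurrences of the axes `child` and `descendant`,
including those in filters. -/
mutual

def LPath.size : LPath S → ℕ
  | .step s => s.size
  | .seq p q => p.size + q.size
  | .union p q => p.size + q.size

def LStep.size : LStep S → ℕ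
  | .base a _ => a.size
  | .filter s e => s.size + e.size

def FExpr.size : FExpr S → ℕ
  | .path p => p.size
  | .or p q => p.size + q.size

end

/- The disjuncts of the disjunctive normal form: all the disjunction-free expressions that arise by
choosing one alternative at each occurrence of `|` and of `or` (independently of each other). -/
mutual

def LPath.dnf : LPath S → List (LPath S)
  | .step s => s.dnf.map .step
  | .seq p q => p.dnf.flatMap fun p' => q.dnf.map fun q' => .seq p' q'
  | .union p q => p.dnf ++ q.dnf

def LStep.dnf : LStep S → List (LStep S)
  | .base a n => [.base a n]
  | .filter s e => s.dnf.flatMap fun s' => e.dnf.map fun e' => .filter s' e'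

def FExpr.dnf : FExpr S → List (FExpr S)
  | .path p => p.dnf.map .path
  | .or p q => (p.dnf ++ q.dnf).map .path

end

/-- The finite alphabet in which expressions are written.  A label is a word over `{0, 1}`. -/
inductive Tok
  | seq
  | union
  | filter
  | or
  | self
  | child
  | descendant
  | wildcard
  | bit (b : Bool)
  | labelEnd
  deriving DecidableEq, Fintype

def Axis.encode : Axis → List Tok
  | .self => [.self]
  | .child => [.child]
  | .descendant => [.descendant]

def NodeTest.encode : NodeTest (List Bool) → List Tok
  | .wildcard => [.wildcard]
  | .label a => a.map .bit ++ [.labelEnd]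

/- Expressions are written in prefix notation. -/
mutual

def LPath.encode : LPath (List Bool) → List Tok
  | .step s => s.encode
  | .seq p q => .seq :: (p.encode ++ q.encode)
  | .union p q => .union :: (p.encode ++ q.encode)

def LStep.encode : LStep (List Bool) → List Tok
  | .base a n => a.encode ++ n.encode
  | .filter s e => .filter :: (s.encode ++ e.encode)

def FExpr.encode : FExpr (List Bool) → List Tok
  | .path p => p.encode
  | .or p q => .or :: (p.encode ++ q.encode)

end

theorem NodeTest.encode_append_inj (n n' : NodeTest (List Bool)) (r r' : List Tok)
    (h : n.encode ++ r = n'.encode ++ r') : n = n' ∧ r = r' := by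
  have key : ∀ (a b : List Bool), a.map Tok.bit ++ Tok.labelEnd :: r = b.map Tok.bit ++ Tok.labelEnd :: r' →
      a = b ∧ r = r' := by
    intro a
    induction a with
    | nil => intro b hb; cases b <;> simp_all
    | cons x a ih =>
      intro b hb
      cases b with
      | nil => simp at hb
      | cons y b =>
        simp only [List.map_cons, List.cons_append, List.cons.injEq, Tok.bit.injEq] at hb
        obtain ⟨h1, h2⟩ := ih b hb.2
        simp [hb.1, h1, h2]
  cases n with
  | wildcard =>
    cases n' with
    | wildcard => simpa [NodeTest.encode] using h
    | label b => cases b <;> simp [NodeTest.encode] at h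
  | label a =>
    cases n' with
    | wildcard => cases a <;> simp [NodeTest.encode] at h
    | label b =>
      simp only [NodeTest.encode, List.append_assoc, List.cons_append, List.nil_append] at h
      simpa using key a b h

mutual

theorem LPath.encode_append_inj : ∀ (p p' : LPath (List Bool)) (r r' : List Tok),
    p.encode ++ r = p'.encode ++ r' → p = p' ∧ r = r'
  | .step s, .step s', r, r', h => by
    have := LStep.encode_append_inj s s' r r' h
    simpa using this
  | .seq p q, .seq p' q', r, r', h => by
    simp only [LPath.encode, List.cons_append, List.append_assoc, List.cons.injEq, true_and] at h
    obtain ⟨h1, h2⟩ := LPath.encode_append_inj p p' _ _ h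
    obtain ⟨h3, h4⟩ := LPath.encode_append_inj q q' _ _ h2
    simp [h1, h3, h4]
  | .union p q, .union p' q', r, r', h => by
    simp only [LPath.encode, List.cons_append, List.append_assoc, List.cons.injEq, true_and] at h
    obtain ⟨h1, h2⟩ := LPath.encode_append_inj p p' _ _ h
    obtain ⟨h3, h4⟩ := LPath.encode_append_inj q q' _ _ h2
    simp [h1, h3, h4]
  | .step s, .seq _ _, r, r', h => by
    rcases s with ⟨a, n⟩ | ⟨s, e⟩
    · cases a <;> simp [LPath.encode, LStep.encode, Axis.encode] at h
    · simp [LPath.encode, LStep.encode] at h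
  | .step s, .union _ _, r, r', h => by
    rcases s with ⟨a, n⟩ | ⟨s, e⟩
    · cases a <;> simp [LPath.encode, LStep.encode, Axis.encode] at h
    · simp [LPath.encode, LStep.encode] at h
  | .seq _ _, .step s, r, r', h => by
    rcases s with ⟨a, n⟩ | ⟨s, e⟩
    · cases a <;> simp [LPath.encode, LStep.encode, Axis.encode] at h
    · simp [LPath.encode, LStep.encode] at h
  | .union _ _, .step s, r, r', h => by
    rcases s with ⟨a, n⟩ | ⟨s, e⟩
    · cases a <;> simp [LPath.encode, LStep.encode, Axis.encode] at h
    · simp [LPath.encode, LStep.encode] at h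
  | .seq _ _, .union _ _, r, r', h => by simp [LPath.encode] at h
  | .union _ _, .seq _ _, r, r', h => by simp [LPath.encode] at h

theorem LStep.encode_append_inj : ∀ (s s' : LStep (List Bool)) (r r' : List Tok),
    s.encode ++ r = s'.encode ++ r' → s = s' ∧ r = r'
  | .base a n, .base a' n', r, r', h => by
    have : a = a' ∧ n.encode ++ r = n'.encode ++ r' := by
      cases a <;> cases a' <;> simp_all [LStep.encode, Axis.encode]
    obtain ⟨h1, h2⟩ := NodeTest.encode_append_inj n n' _ _ this.2
    simp [this.1, h1, h2]
  | .filter s e, .filter s' e', r, r', h => by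
    simp only [LStep.encode, List.cons_append, List.append_assoc, List.cons.injEq, true_and] at h
    obtain ⟨h1, h2⟩ := LStep.encode_append_inj s s' _ _ h
    obtain ⟨h3, h4⟩ := FExpr.encode_append_inj e e' _ _ h2
    simp [h1, h3, h4]
  | .base a n, .filter s e, r, r', h => by
    cases a <;> simp [LStep.encode, Axis.encode] at h
  | .filter s e, .base a n, r, r', h => by
    cases a <;> simp [LStep.encode, Axis.encode] at h

theorem FExpr.encode_append_inj : ∀ (e e' : FExpr (List Bool)) (r r' : List Tok),
    e.encode ++ r = e'.encode ++ r' → e = e' ∧ r = r'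
  | .path p, .path p', r, r', h => by
    have := LPath.encode_append_inj p p' r r' h
    simpa using this
  | .or p q, .or p' q', r, r', h => by
    simp only [FExpr.encode, List.cons_append, List.append_assoc, List.cons.injEq, true_and] at h
    obtain ⟨h1, h2⟩ := LPath.encode_append_inj p p' _ _ h
    obtain ⟨h3, h4⟩ := LPath.encode_append_inj q q' _ _ h2
    simp [h1, h3, h4]
  | .path p, .or _ _, r, r', h => by
    rcases p with (⟨a, n⟩ | ⟨s, e⟩) | ⟨p, q⟩ | ⟨p, q⟩
    · cases a <;> simp [FExpr.encode, LPath.encode, LStep.encode, Axis.encode] at h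
    all_goals simp [FExpr.encode, LPath.encode, LStep.encode] at h
  | .or _ _, .path p, r, r', h => by
    rcases p with (⟨a, n⟩ | ⟨s, e⟩) | ⟨p, q⟩ | ⟨p, q⟩
    · cases a <;> simp [FExpr.encode, LPath.encode, LStep.encode, Axis.encode] at h
    all_goals simp [FExpr.encode, LPath.encode, LStep.encode] at h

end

/-- The code of an instance of the containment problem. -/
def encodeInstance (x : LPath (List Bool) × LPath (List Bool)) : List Tok :=
  x.1.encode ++ x.2.encode

/-- Distinct instances have distinct codes. -/
theorem encodeInstance_injective : Function.Injective encodeInstance := by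
  rintro ⟨p, q⟩ ⟨p', q'⟩ h
  obtain ⟨h1, h2⟩ := LPath.encode_append_inj p p' _ _ h
  obtain ⟨h3, -⟩ := LPath.encode_append_inj q q' [] [] (by simpa using h2)
  simp [h1, h3]

/-- The containment problem as a set of words: the codes of the pairs `(p, q)` with `p ⊆ q`. -/
def containmentProblem : Set (List Tok) :=
  {w | ∃ p q : LPath (List Bool), w = encodeInstance (p, q) ∧ p.Contained q}

/-- The class NP, by polynomial-time verifiers: a Turing machine decides in time polynomial in its
input, a word `w` followed by a certificate `c`, whether `c` is a certificate for `w`; and `w` is in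
`L` if and only if it has a certificate of length polynomial in the length of `w`. -/
def InNP {Γ : Type} (L : Set (List Γ)) : Prop :=
  ∃ (Δ : Type) (_ : Fintype Δ) (V : List Γ × List Δ → Bool) (B : Polynomial ℕ),
    Nonempty (Turing.TM2ComputableInPolyTime
      (Computability.encodingProd (Computability.encodingList Γ)
        (Computability.encodingList Δ)).encode
      Computability.encodeBool V) ∧
    ∀ w : List Γ, w ∈ L ↔ ∃ c : List Δ, c.length ≤ B.eval w.length ∧ V (w, c) = true

/-- The class coNP: the complements of the languages in NP. -/
def InCoNP {Γ : Type} (L : Set (List Γ)) : Prop := InNP Lᶜ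

end XPathContainment

namespace XPathContainment

universe u v w

variable {S : Type u}

/-! ### Evaluation over labelled transition structures -/

/-- A set of vertices with a child relation and a labelling. -/
structure Model (S : Type u) where
  V : Type v
  child : V → V → Prop
  lab : V → S

/-- The backward image of a set of vertices along an axis. -/
def Axis.pre (M : Model.{u, v} S) : Axis → (M.V → Prop) → M.V → Prop
  | .self, X, u => X u
  | .child, X, u => ∃ v, M.child u v ∧ X v
  | .descendant, X, u => ∃ v, Relation.TransGen M.child u v ∧ X v

mutual

/-- The backward image of a set of vertices along a location path. -/
def LPath.pre (M : Model.{u, v} S) : LPath S → (M.V → Prop) → M.V → Prop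
  | .step s, X => s.pre M X
  | .seq p q, X => p.pre M (q.pre M X)
  | .union p q, X => fun u => p.pre M X u ∨ q.pre M X u

/-- The backward image of a set of vertices along a location step. -/
def LStep.pre (M : Model.{u, v} S) : LStep S → (M.V → Prop) → M.V → Prop
  | .base a n, X => a.pre M fun v => n.Holds (M.lab v) ∧ X v
  | .filter s e, X => s.pre M fun v => e.pre M v ∧ X v

/-- The set of vertices at which a filter is true. -/
def FExpr.pre (M : Model.{u, v} S) : FExpr S → M.V → Prop
  | .path p => p.pre M fun _ => True
  | .or p q => fun u => p.pre M (fun _ => True) u ∨ q.pre M (fun _ => True) u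

end

/-- The structure formed by the vertices of a tree. -/
abbrev XMLTree.model (t : XMLTree S) : Model.{u, 0} S where
  V := {v : List ℕ // v ∈ t.dom}
  child u v := ∃ i : ℕ, v.1 = u.1 ++ [i]
  lab v := t.lab v.1

theorem XMLTree.transGen_child_iff (t : XMLTree S) (u v : t.model.V) :
    Relation.TransGen t.model.child u v ↔ ∃ w : List ℕ, w ≠ [] ∧ v.1 = u.1 ++ w := by
  constructor
  · intro h
    induction h with
    | single h =>
      obtain ⟨i, hi⟩ := h
      exact ⟨[i], by simp, hi⟩
    | tail _ h ih =>
      obtain ⟨i, hi⟩ := h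
      obtain ⟨w, -, hw⟩ := ih
      exact ⟨w ++ [i], by simp, by rw [hi, hw, List.append_assoc]⟩
  · rintro ⟨w, hw, hv⟩
    obtain ⟨v, hd⟩ := v
    simp only at hv
    subst hv
    induction w using List.reverseRecOn with
    | nil => exact absurd rfl hw
    | append_singleton w i ih =>
      have hd' : u.1 ++ w ∈ t.dom := by
        rw [← List.append_assoc] at hd
        exact t.parent_mem _ _ hd
      have hc : t.model.child ⟨u.1 ++ w, hd'⟩ ⟨u.1 ++ (w ++ [i]), hd⟩ :=
        ⟨i, by simp⟩
      by_cases h0 : w = []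
      · subst h0
        exact Relation.TransGen.single ⟨i, by simp⟩
      · exact (ih h0 hd').tail hc

theorem Axis.pre_model (t : XMLTree S) (a : Axis) (X : List ℕ → Prop) (u : t.model.V) :
    a.pre t.model (fun v => X v.1) u ↔ ∃ v ∈ t.dom, a.Rel u.1 v ∧ X v := by
  cases a with
  | self =>
    constructor
    · exact fun h => ⟨u.1, u.2, rfl, h⟩
    · rintro ⟨v, _, rfl, h⟩
      exact h
  | child =>
    constructor
    · rintro ⟨v, h, hX⟩
      exact ⟨v.1, v.2, h, hX⟩
    · rintro ⟨v, hv, h, hX⟩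
      exact ⟨⟨v, hv⟩, h, hX⟩
  | descendant =>
    constructor
    · rintro ⟨v, h, hX⟩
      exact ⟨v.1, v.2, (t.transGen_child_iff u v).1 h, hX⟩
    · rintro ⟨v, hv, h, hX⟩
      exact ⟨⟨v, hv⟩, (t.transGen_child_iff u ⟨v, hv⟩).2 h, hX⟩

mutual

theorem LPath.pre_model (t : XMLTree S) : ∀ (p : LPath S) (X : List ℕ → Prop) (u : t.model.V),
    p.pre t.model (fun v => X v.1) u ↔ ∃ v, p.Sem t u.1 v ∧ v ∈ t.dom ∧ X v
  | .step s, X, u => LStep.pre_model t s X u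
  | .seq p q, X, u => by
    have hq : q.pre t.model (fun v => X v.1) =
        fun w => (fun w => ∃ v, q.Sem t w v ∧ v ∈ t.dom ∧ X v) w.1 :=
      funext fun w => propext (LPath.pre_model t q X w)
    rw [LPath.pre, hq]
    refine (LPath.pre_model t p (fun w => ∃ v, q.Sem t w v ∧ v ∈ t.dom ∧ X v) u).trans ⟨?_, ?_⟩
    · rintro ⟨w, h, -, v, h', hv, hX⟩
      exact ⟨v, ⟨w, h, h'⟩, hv, hX⟩
    · rintro ⟨v, ⟨w, h, h'⟩, hv, hX⟩
      exact ⟨w, h, LPath.mem_of_sem t p u.2 h, v, h', hv, hX⟩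
  | .union p q, X, u => by
    simp only [LPath.pre, LPath.pre_model t p, LPath.pre_model t q, LPath.Sem, or_and_right,
      exists_or]

theorem LStep.pre_model (t : XMLTree S) : ∀ (s : LStep S) (X : List ℕ → Prop) (u : t.model.V),
    s.pre t.model (fun v => X v.1) u ↔ ∃ v, s.Sem t u.1 v ∧ v ∈ t.dom ∧ X v
  | .base a n, X, u => by
    have := Axis.pre_model t a (fun v => n.Holds (t.lab v) ∧ X v) u
    rw [LStep.pre]
    refine this.trans ⟨?_, ?_⟩
    · rintro ⟨v, hv, h, hn, hX⟩
      exact ⟨v, ⟨u.2, hv, h, hn⟩, hv, hX⟩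
    · rintro ⟨v, ⟨-, hv, h, hn⟩, -, hX⟩
      exact ⟨v, hv, h, hn, hX⟩
  | .filter s e, X, u => by
    have he : (fun v : t.model.V => e.pre t.model v ∧ X v.1) =
        fun v => (fun v => e.Holds t v ∧ X v) v.1 :=
      funext fun v => propext (and_congr_left fun _ => FExpr.pre_model t e v)
    rw [LStep.pre, he]
    refine (LStep.pre_model t s (fun v => e.Holds t v ∧ X v) u).trans ⟨?_, ?_⟩
    · rintro ⟨v, h, hv, he, hX⟩
      exact ⟨v, ⟨h, he⟩, hv, hX⟩
    · rintro ⟨v, ⟨h, he⟩, hv, hX⟩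
      exact ⟨v, h, hv, he, hX⟩

theorem FExpr.pre_model (t : XMLTree S) : ∀ (e : FExpr S) (u : t.model.V),
    e.pre t.model u ↔ e.Holds t u.1
  | .path p, u => by
    rw [FExpr.pre, FExpr.Holds]
    refine (LPath.pre_model t p (fun _ => True) u).trans ⟨?_, ?_⟩
    · rintro ⟨v, h, -⟩
      exact ⟨v, h⟩
    · rintro ⟨v, h⟩
      exact ⟨v, h, LPath.mem_of_sem t p u.2 h, trivial⟩
  | .or p q, u => by
    rw [FExpr.pre, FExpr.Holds]
    refine or_congr ((LPath.pre_model t p (fun _ => True) u).trans ⟨?_, ?_⟩)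
      ((LPath.pre_model t q (fun _ => True) u).trans ⟨?_, ?_⟩)
    · rintro ⟨v, h, -⟩
      exact ⟨v, h⟩
    · rintro ⟨v, h⟩
      exact ⟨v, h, LPath.mem_of_sem t p u.2 h, trivial⟩
    · rintro ⟨v, h, -⟩
      exact ⟨v, h⟩
    · rintro ⟨v, h⟩
      exact ⟨v, h, LPath.mem_of_sem t q u.2 h, trivial⟩

theorem LPath.mem_of_sem (t : XMLTree S) : ∀ (p : LPath S) {u v : List ℕ}, u ∈ t.dom →
    p.Sem t u v → v ∈ t.dom
  | .step s, _, _, hu, h => LStep.mem_of_sem t s hu h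
  | .seq p q, _, _, hu, ⟨_, h, h'⟩ => LPath.mem_of_sem t q (LPath.mem_of_sem t p hu h) h'
  | .union p _, _, _, hu, .inl h => LPath.mem_of_sem t p hu h
  | .union _ q, _, _, hu, .inr h => LPath.mem_of_sem t q hu h

theorem LStep.mem_of_sem (t : XMLTree S) : ∀ (s : LStep S) {u v : List ℕ}, u ∈ t.dom →
    s.Sem t u v → v ∈ t.dom
  | .base _ _, _, _, _, h => h.2.1
  | .filter s _, _, _, hu, h => LStep.mem_of_sem t s hu h.1

end

/-- The root of a tree. -/
def XMLTree.root (t : XMLTree S) : t.model.V := ⟨[], t.root_mem⟩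

theorem XMLTree.matches_iff (t : XMLTree S) (p : LPath S) :
    t.Matches p ↔ p.pre t.model (fun _ => True) t.root := by
  refine Iff.symm ((LPath.pre_model t p (fun _ => True) t.root).trans ⟨?_, ?_⟩)
  · rintro ⟨v, h, -⟩
    exact ⟨v, h⟩
  · rintro ⟨v, h⟩
    exact ⟨v, h, LPath.mem_of_sem t p t.root_mem h, trivial⟩

/-- A bounded morphism of labelled transition structures. -/
structure Model.Hom (M : Model.{u, v} S) (N : Model.{u, w} S) where
  map : M.V → N.V
  lab_map : ∀ x, N.lab (map x) = M.lab x
  forth : ∀ {x y}, M.child x y → N.child (map x) (map y)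
  back : ∀ {x y'}, N.child (map x) y' → ∃ y, M.child x y ∧ map y = y'

theorem Axis.pre_map {M : Model.{u, v} S} {N : Model.{u, w} S} (φ : M.Hom N) (a : Axis)
    (X : N.V → Prop) (x : M.V) : a.pre M (fun y => X (φ.map y)) x ↔ a.pre N X (φ.map x) := by
  cases a with
  | self => exact Iff.rfl
  | child =>
    constructor
    · rintro ⟨v, h, hX⟩
      exact ⟨_, φ.forth h, hX⟩
    · rintro ⟨v, h, hX⟩
      obtain ⟨y, hy, rfl⟩ := φ.back h
      exact ⟨y, hy, hX⟩
  | descendant =>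
    constructor
    · rintro ⟨v, h, hX⟩
      exact ⟨_, h.lift φ.map fun _ _ => φ.forth, hX⟩
    · rintro ⟨v, h, hX⟩
      have key : ∀ z, Relation.TransGen N.child (φ.map x) z →
          ∃ y, Relation.TransGen M.child x y ∧ φ.map y = z := by
        intro z hz
        induction hz with
        | single h =>
          obtain ⟨y, hy, rfl⟩ := φ.back h
          exact ⟨y, .single hy, rfl⟩
        | tail _ h ih =>
          obtain ⟨y, hy, rfl⟩ := ih
          obtain ⟨y', hy', rfl⟩ := φ.back h
          exact ⟨y', hy.tail hy', rfl⟩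
      obtain ⟨y, hy, rfl⟩ := key v h
      exact ⟨y, hy, hX⟩

mutual

theorem LPath.pre_map {M : Model.{u, v} S} {N : Model.{u, w} S} (φ : M.Hom N) :
    ∀ (p : LPath S) (X : N.V → Prop),
      (p.pre M fun y => X (φ.map y)) = fun x => p.pre N X (φ.map x)
  | .step s, X => LStep.pre_map φ s X
  | .seq p q, X => by
    rw [LPath.pre, LPath.pre_map φ q X, LPath.pre_map φ p]
    rfl
  | .union p q, X => by
    rw [LPath.pre, LPath.pre_map φ q X, LPath.pre_map φ p X]
    rfl

theorem LStep.pre_map {M : Model.{u, v} S} {N : Model.{u, w} S} (φ : M.Hom N) :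
    ∀ (s : LStep S) (X : N.V → Prop),
      (s.pre M fun y => X (φ.map y)) = fun x => s.pre N X (φ.map x)
  | .base a n, X => by
    funext x
    simp only [LStep.pre, ← φ.lab_map]
    exact propext (Axis.pre_map φ a (fun v => n.Holds (N.lab v) ∧ X v) x)
  | .filter s e, X => by
    rw [LStep.pre, FExpr.pre_map φ e, LStep.pre_map φ s fun v => e.pre N v ∧ X v]
    rfl

theorem FExpr.pre_map {M : Model.{u, v} S} {N : Model.{u, w} S} (φ : M.Hom N) :
    ∀ e : FExpr S, e.pre M = fun x => e.pre N (φ.map x)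
  | .path p => LPath.pre_map φ p fun _ => True
  | .or p q => by
    rw [FExpr.pre, LPath.pre_map φ p fun _ => True, LPath.pre_map φ q fun _ => True]
    rfl

end

/-! ### Ordered forests -/

/-- Finite ordered forests: a first tree, given by its root label and the forest below its root,
followed by the remaining trees. -/
inductive Forest (S : Type u)
  | nil
  | cons (a : S) (kids sibs : Forest S)

/-- A tree, given by its root label and the forest below its root. -/
abbrev Node (S : Type u) := S × Forest S

namespace Forest

/-- `f.Mem n`: one of the trees of `f` is `n`. -/
def Mem (n : Node S) : Forest S → Prop
  | nil => False
  | cons a k s => n = (a, k) ∨ s.Mem n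

def append : Forest S → Forest S → Forest S
  | nil, g => g
  | cons a k s, g => cons a k (s.append g)

def size : Forest S → ℕ
  | nil => 0
  | cons _ k s => k.size + s.size + 1

def labels : Forest S → Set S
  | nil => ∅
  | cons a k s => {a} ∪ k.labels ∪ s.labels

theorem mem_append {n : Node S} {f g : Forest S} : (f.append g).Mem n ↔ f.Mem n ∨ g.Mem n := by
  induction f with
  | nil => simp [append, Mem]
  | cons a k s _ ih => simp [append, Mem, ih, or_assoc]

theorem size_append (f g : Forest S) : (f.append g).size = f.size + g.size := by
  induction f with
  | nil => simp [append, size]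
  | cons a k s _ ih => simp only [append, size, ih]; omega

theorem labels_append (f g : Forest S) : (f.append g).labels = f.labels ∪ g.labels := by
  induction f with
  | nil => simp [append, labels]
  | cons a k s _ ih => simp [append, labels, ih, Set.union_assoc]

/-- The `i`-th tree of a forest. -/
def get : Forest S → ℕ → Option (Node S)
  | nil, _ => none
  | cons a k _, 0 => some (a, k)
  | cons _ _ s, i + 1 => s.get i

theorem mem_iff_get {n : Node S} {f : Forest S} : f.Mem n ↔ ∃ i, f.get i = some n := by
  induction f with
  | nil => simp [Mem, get]
  | cons a k s _ ih =>
    rw [Mem, ih]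
    constructor
    · rintro (rfl | ⟨i, hi⟩)
      · exact ⟨0, rfl⟩
      · exact ⟨i + 1, hi⟩
    · rintro ⟨_ | i, hi⟩
      · exact .inl (Option.some.inj hi).symm
      · exact .inr ⟨i, hi⟩

theorem get_isSome_of_succ {f : Forest S} {i : ℕ} (h : (f.get (i + 1)).isSome) :
    (f.get i).isSome := by
  induction f generalizing i with
  | nil => simp [get] at h
  | cons a k s _ ih =>
    cases i with
    | zero => rfl
    | succ i => exact ih h

end Forest

/-- The subtree at a position of a tree. -/
def Node.at : Node S → List ℕ → Option (Node S)
  | n, [] => some n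
  | n, i :: v => (n.2.get i).bind fun n' => Node.at n' v

theorem Node.at_append (n : Node S) (v w : List ℕ) :
    n.at (v ++ w) = (n.at v).bind fun n' => n'.at w := by
  induction v generalizing n with
  | nil => simp [Node.at]
  | cons i v ih =>
    simp only [Node.at, List.cons_append, Option.bind_assoc]
    congr 1
    funext n'
    exact ih n'

theorem Node.at_singleton (n : Node S) (i : ℕ) : n.at [i] = n.2.get i := by
  simp [Node.at]

/-- The positions of the vertices of a forest whose trees are numbered from `i`. -/
def Forest.dom : Forest S → ℕ → Finset (List ℕ)
  | .nil, _ => ∅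
  | .cons _ k s, i => insert [i] ((k.dom 0).image (i :: ·)) ∪ s.dom (i + 1)

theorem Forest.card_dom_le (f : Forest S) (i : ℕ) : (f.dom i).card ≤ f.size := by
  induction f generalizing i with
  | nil => simp [Forest.dom]
  | cons a k s ihk ihs =>
    have h1 := Finset.card_union_le (insert [i] ((k.dom 0).image (i :: ·))) (s.dom (i + 1))
    have h2 := Finset.card_insert_le [i] ((k.dom 0).image (i :: ·))
    have h3 := Finset.card_image_le (s := k.dom 0) (f := (i :: ·))
    have := ihk 0
    have := ihs (i + 1)
    simp only [Forest.dom, Forest.size]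
    omega

theorem Forest.mem_dom {f : Forest S} {i : ℕ} {v : List ℕ} :
    v ∈ f.dom i ↔ ∃ j w, v = (i + j) :: w ∧ ((f.get j).bind fun n => n.at w).isSome := by
  induction f generalizing i v with
  | nil => simp [Forest.dom, Forest.get]
  | cons a k s ihk ihs =>
    simp only [Forest.dom, Finset.mem_union, Finset.mem_insert, Finset.mem_image, ihk, ihs]
    constructor
    · rintro ((rfl | ⟨_, ⟨j, w, rfl, h⟩, rfl⟩) | ⟨j, w, rfl, h⟩)
      · exact ⟨0, [], rfl, rfl⟩
      · exact ⟨0, (0 + j) :: w, rfl, by simpa [Forest.get, Node.at] using h⟩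
      · exact ⟨j + 1, w, by rw [Nat.add_right_comm, Nat.add_assoc], h⟩
    · rintro ⟨_ | j, w, rfl, h⟩
      · cases w with
        | nil => exact .inl (.inl rfl)
        | cons j w =>
          exact .inl (.inr ⟨_, ⟨j, w, rfl, by simpa [Forest.get, Node.at] using h⟩, by simp⟩)
      · exact .inr ⟨j, w, by rw [Nat.add_right_comm, Nat.add_assoc], h⟩

theorem Node.mem_dom {n : Node S} {v : List ℕ} :
    v ∈ insert [] (n.2.dom 0) ↔ (n.at v).isSome := by
  rw [Finset.mem_insert, Forest.mem_dom]
  cases v with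
  | nil => simp [Node.at]
  | cons i v => simp [Node.at]

/-- The tree whose vertices are the positions of a tree given as a forest. -/
def Node.toTree (n : Node S) : XMLTree S where
  dom := insert [] (n.2.dom 0)
  root_mem := Finset.mem_insert_self _ _
  parent_mem v i h := by
    rw [Node.mem_dom, Node.at_append] at *
    cases h' : n.at v <;> simp_all
  sibling_mem v i h := by
    rw [Node.mem_dom, Node.at_append] at *
    cases h' : n.at v with
    | none => simp_all
    | some n' =>
      simp only [h', Option.bind_some, Node.at_singleton] at h ⊢
      exact Forest.get_isSome_of_succ h
  lab v := ((n.at v).getD n).1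

/-- Trees, with the relation that holds between a tree and its immediate subtrees. -/
abbrev forestModel (S : Type u) : Model.{u, u} S where
  V := Node S
  child n n' := n.2.Mem n'
  lab n := n.1

theorem Node.isSome_at_of_mem (n : Node S) (v : n.toTree.model.V) : (n.at v.1).isSome :=
  Node.mem_dom.1 v.2

theorem Node.at_eq (n : Node S) (v : n.toTree.model.V) :
    n.at v.1 = some ((n.at v.1).getD n) := by
  have := n.isSome_at_of_mem v
  cases h : n.at v.1 <;> simp_all

/-- A vertex of a tree is sent to the subtree below it. -/
def Node.hom (n : Node S) : n.toTree.model.Hom (forestModel S) where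
  map v := (n.at v.1).getD n
  lab_map _ := rfl
  forth := by
    rintro x y ⟨i, hi⟩
    have hx := n.at_eq x
    have hy := n.at_eq y
    refine Forest.mem_iff_get.2 ⟨i, Eq.trans ?_ hy⟩
    generalize (n.at x.1).getD n = z at hx
    rw [hi, Node.at_append, hx, Option.bind_some, Node.at_singleton]
  back := by
    intro x y' h
    obtain ⟨i, hi⟩ := Forest.mem_iff_get.1 h
    have hy : n.at (x.1 ++ [i]) = some y' := by
      rw [Node.at_append, n.at_eq x, Option.bind_some, Node.at_singleton, hi]
    exact ⟨⟨x.1 ++ [i], Node.mem_dom.2 (by simp [hy])⟩, ⟨i, rfl⟩, by simp [hy]⟩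

/-- The truth of a location path at the root of a tree given as a forest. -/
def Node.Matches (n : Node S) (p : LPath S) : Prop := p.pre (forestModel S) (fun _ => True) n

theorem Node.matches_toTree (n : Node S) (p : LPath S) : n.toTree.Matches p ↔ n.Matches p := by
  rw [XMLTree.matches_iff]
  exact iff_of_eq (congrFun (LPath.pre_map n.hom p fun _ => True) n.toTree.root)

theorem Node.card_toTree_le (n : Node S) : n.toTree.dom.card ≤ n.2.size + 1 :=
  (Finset.card_insert_le _ _).trans (Nat.add_le_add_right (n.2.card_dom_le 0) 1)

theorem Forest.labels_subset_of_mem {f : Forest S} {n : Node S} (h : f.Mem n) :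
    n.1 ∈ f.labels ∧ n.2.labels ⊆ f.labels := by
  induction f with
  | nil => exact h.elim
  | cons a k s _ ih =>
    rcases h with rfl | h
    · exact ⟨by simp [Forest.labels], fun x hx => by simp [Forest.labels, hx]⟩
    · obtain ⟨h1, h2⟩ := ih h
      exact ⟨by simp [Forest.labels, h1], fun x hx => by simp [Forest.labels, h2 hx]⟩

theorem Node.lab_at_mem {n n' : Node S} {v : List ℕ} (h : n.at v = some n') :
    n'.1 ∈ {n.1} ∪ n.2.labels := by
  induction v generalizing n with
  | nil => simp_all [Node.at]
  | cons i v ih =>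
    obtain ⟨k, hk, h⟩ := Option.bind_eq_some_iff.1 h
    obtain ⟨h1, h2⟩ := Forest.labels_subset_of_mem (Forest.mem_iff_get.2 ⟨i, hk⟩)
    rcases ih h with h | h
    · exact .inr (h ▸ h1)
    · exact .inr (h2 h)

theorem Node.lab_toTree_mem (n : Node S) {v : List ℕ} (h : v ∈ n.toTree.dom) :
    n.toTree.lab v ∈ {n.1} ∪ n.2.labels :=
  Node.lab_at_mem (n.at_eq ⟨v, h⟩)

/-! ### Positive formulas -/

/-- Positive modal formulas without disjunction. -/
inductive Formula (S : Type u)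
  | top
  | lab (a : S)
  | and (f g : Formula S)
  | child (f : Formula S)
  | desc (f : Formula S)

namespace Formula

def Sat (M : Model.{u, v} S) : Formula S → M.V → Prop
  | top, _ => True
  | lab a, u => M.lab u = a
  | and f g, u => f.Sat M u ∧ g.Sat M u
  | child f, u => ∃ v, M.child u v ∧ f.Sat M v
  | desc f, u => ∃ v, Relation.TransGen M.child u v ∧ f.Sat M v

def size : Formula S → ℕ
  | top => 0
  | lab _ => 0
  | and f g => f.size + g.size
  | child f => f.size + 1
  | desc f => f.size + 1

def labels : Formula S → Set S
  | top => ∅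
  | lab a => {a}
  | and f g => f.labels ∪ g.labels
  | child f => f.labels
  | desc f => f.labels

/-- The labels that a formula requires at the vertex where it is evaluated. -/
def rootLabels : Formula S → Set S
  | lab a => {a}
  | and f g => f.rootLabels ∪ g.rootLabels
  | _ => ∅

theorem rootLabels_subset (f : Formula S) : f.rootLabels ⊆ f.labels := by
  induction f with
  | and f g ihf ihg => exact Set.union_subset_union ihf ihg
  | lab a => exact subset_rfl
  | _ => exact Set.empty_subset _

theorem Sat.lab_eq {M : Model.{u, v} S} {f : Formula S} {x : M.V} (h : f.Sat M x) {a : S}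
    (ha : a ∈ f.rootLabels) : M.lab x = a := by
  induction f with
  | and f g ihf ihg => exact ha.elim (ihf h.1) (ihg h.2)
  | lab b => exact Eq.trans h ha.symm
  | _ => exact ha.elim

end Formula

def NodeTest.formula : NodeTest S → Formula S
  | .wildcard => .top
  | .label a => .lab a

def Axis.formula : Axis → Formula S → Formula S
  | .self, f => f
  | .child, f => .child f
  | .descendant, f => .desc f

mutual

/-- The formula expressing the backward image along a location path without disjunction. -/
def LPath.formula : LPath S → Formula S → Formula S
  | .step s, f => s.formula f
  | .seq p q, f => p.formula (q.formula f)
  | .union p _, f => p.formula f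

def LStep.formula : LStep S → Formula S → Formula S
  | .base a n, f => a.formula (.and n.formula f)
  | .filter s e, f => s.formula (.and e.formula f)

def FExpr.formula : FExpr S → Formula S
  | .path p => p.formula .top
  | .or p _ => p.formula .top

end

theorem NodeTest.labels_formula (n : NodeTest S) : n.formula.labels = n.labels := by
  cases n <;> rfl

theorem NodeTest.size_formula (n : NodeTest S) : n.formula.size = 0 := by
  cases n <;> rfl

theorem NodeTest.sat_formula (M : Model.{u, v} S) (n : NodeTest S) (x : M.V) :
    n.formula.Sat M x ↔ n.Holds (M.lab x) := by
  cases n <;> rfl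

theorem Axis.sat_formula (M : Model.{u, v} S) (a : Axis) (f : Formula S) :
    (a.formula f).Sat M = a.pre M (f.Sat M) := by
  cases a <;> rfl

mutual

theorem LPath.size_formula_le : ∀ (p : LPath S) (f : Formula S),
    (p.formula f).size ≤ p.size + f.size
  | .step s, f => LStep.size_formula_le s f
  | .seq p q, f => by
    have h1 := LPath.size_formula_le p (q.formula f)
    have h2 := LPath.size_formula_le q f
    simp only [LPath.formula, LPath.size]
    omega
  | .union p _, f => by
    have h1 := LPath.size_formula_le p f
    simp only [LPath.formula, LPath.size]
    omega

theorem LStep.size_formula_le : ∀ (s : LStep S) (f : Formula S),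
    (s.formula f).size ≤ s.size + f.size
  | .base a n, f => by
    cases a <;>
      simp only [LStep.formula, Axis.formula, Formula.size, n.size_formula, LStep.size,
        Axis.size] <;> omega
  | .filter s e, f => by
    have h1 := LStep.size_formula_le s (.and e.formula f)
    have h2 := FExpr.size_formula_le e
    simp only [Formula.size] at h1
    simp only [LStep.formula, LStep.size]
    omega

theorem FExpr.size_formula_le : ∀ e : FExpr S, e.formula.size ≤ e.size
  | .path p => LPath.size_formula_le p .top
  | .or p _ => (LPath.size_formula_le p .top).trans (Nat.add_le_add_left (Nat.zero_le _) _)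

end

mutual

theorem LPath.labels_formula_subset : ∀ (p : LPath S) (f : Formula S),
    (p.formula f).labels ⊆ p.labels ∪ f.labels
  | .step s, f => LStep.labels_formula_subset s f
  | .seq p q, f => by
    have h1 := LPath.labels_formula_subset p (q.formula f)
    have h2 := LPath.labels_formula_subset q f
    simp only [LPath.formula, LPath.labels]
    rw [Set.union_assoc]
    exact h1.trans (Set.union_subset_union_right _ h2)
  | .union p q, f => by
    have h1 := LPath.labels_formula_subset p f
    simp only [LPath.formula, LPath.labels]
    exact h1.trans (Set.union_subset_union_left _ Set.subset_union_left)

theorem LStep.labels_formula_subset : ∀ (s : LStep S) (f : Formula S),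
    (s.formula f).labels ⊆ s.labels ∪ f.labels
  | .base a n, f => by
    cases a <;>
      simp [LStep.formula, Axis.formula, Formula.labels, n.labels_formula, LStep.labels]
  | .filter s e, f => by
    have h1 := LStep.labels_formula_subset s (.and e.formula f)
    have h2 := FExpr.labels_formula_subset e
    simp only [LStep.formula, LStep.labels]
    rw [Set.union_assoc]
    exact h1.trans (Set.union_subset_union_right _ (Set.union_subset_union_left _ h2))

theorem FExpr.labels_formula_subset : ∀ e : FExpr S, e.formula.labels ⊆ e.labels
  | .path p => (LPath.labels_formula_subset p .top).trans (by simp [Formula.labels, FExpr.labels])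
  | .or p q => (LPath.labels_formula_subset p .top).trans (by simp [Formula.labels, FExpr.labels])

end

mutual

theorem LPath.labels_subset_of_mem_dnf : ∀ (p : LPath S) {d : LPath S}, d ∈ p.dnf →
    d.labels ⊆ p.labels
  | .step s, d, hd => by
    obtain ⟨s', hs, rfl⟩ := List.mem_map.1 hd
    exact LStep.labels_subset_of_mem_dnf s hs
  | .seq p q, d, hd => by
    obtain ⟨p', hp, hd⟩ := List.mem_flatMap.1 hd
    obtain ⟨q', hq, rfl⟩ := List.mem_map.1 hd
    exact Set.union_subset_union (LPath.labels_subset_of_mem_dnf p hp)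
      (LPath.labels_subset_of_mem_dnf q hq)
  | .union p q, d, hd => by
    rcases List.mem_append.1 hd with hd | hd
    · exact (LPath.labels_subset_of_mem_dnf p hd).trans Set.subset_union_left
    · exact (LPath.labels_subset_of_mem_dnf q hd).trans Set.subset_union_right

theorem LStep.labels_subset_of_mem_dnf : ∀ (s : LStep S) {d : LStep S}, d ∈ s.dnf →
    d.labels ⊆ s.labels
  | .base a n, d, hd => by
    rw [List.mem_singleton.1 hd]
  | .filter s e, d, hd => by
    obtain ⟨p', hp, hd⟩ := List.mem_flatMap.1 hd
    obtain ⟨q', hq, rfl⟩ := List.mem_map.1 hd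
    exact Set.union_subset_union (LStep.labels_subset_of_mem_dnf s hp)
      (FExpr.labels_subset_of_mem_dnf e hq)

theorem FExpr.labels_subset_of_mem_dnf : ∀ (e : FExpr S) {d : FExpr S}, d ∈ e.dnf →
    d.labels ⊆ e.labels
  | .path p, d, hd => by
    obtain ⟨s', hs, rfl⟩ := List.mem_map.1 hd
    exact LPath.labels_subset_of_mem_dnf p hs
  | .or p q, d, hd => by
    obtain ⟨s', hs, rfl⟩ := List.mem_map.1 hd
    rcases List.mem_append.1 hs with hd | hd
    · exact (LPath.labels_subset_of_mem_dnf p hd).trans Set.subset_union_left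
    · exact (LPath.labels_subset_of_mem_dnf q hd).trans Set.subset_union_right

end

theorem Axis.pre_exists (M : Model.{u, v} S) {ι : Type*} (a : Axis) (X : ι → M.V → Prop) :
    (a.pre M fun x => ∃ i, X i x) = fun x => ∃ i, a.pre M (X i) x := by
  funext x
  cases a with
  | self => rfl
  | child => exact propext ⟨fun ⟨y, h, i, hi⟩ => ⟨i, y, h, hi⟩, fun ⟨i, y, h, hi⟩ => ⟨y, h, i, hi⟩⟩
  | descendant =>
    exact propext ⟨fun ⟨y, h, i, hi⟩ => ⟨i, y, h, hi⟩, fun ⟨i, y, h, hi⟩ => ⟨y, h, i, hi⟩⟩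

mutual

theorem LPath.pre_exists (M : Model.{u, v} S) {ι : Type*} : ∀ (p : LPath S) (X : ι → M.V → Prop),
    (p.pre M fun x => ∃ i, X i x) = fun x => ∃ i, p.pre M (X i) x
  | .step s, X => LStep.pre_exists M s X
  | .seq p q, X => by
    simp only [LPath.pre]
    rw [LPath.pre_exists M q X, LPath.pre_exists M p]
  | .union p q, X => by
    simp only [LPath.pre]
    rw [LPath.pre_exists M q X, LPath.pre_exists M p X]
    funext x
    exact propext exists_or.symm

theorem LStep.pre_exists (M : Model.{u, v} S) {ι : Type*} : ∀ (s : LStep S) (X : ι → M.V → Prop),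
    (s.pre M fun x => ∃ i, X i x) = fun x => ∃ i, s.pre M (X i) x
  | .base a n, X => by
    simp only [LStep.pre, ← exists_and_left]
    rw [Axis.pre_exists]
  | .filter s e, X => by
    simp only [LStep.pre, ← exists_and_left]
    rw [LStep.pre_exists M s]

end

mutual

/-- A location path is equivalent to the disjunction of its disjuncts. -/
theorem LPath.pre_sat (M : Model.{u, v} S) : ∀ (p : LPath S) (f : Formula S),
    p.pre M (f.Sat M) = fun x => ∃ d : {d // d ∈ p.dnf}, (d.1.formula f).Sat M x
  | .step s, f => by
    rw [LPath.pre, LStep.pre_sat M s f]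
    funext x
    simp [LPath.dnf, LPath.formula]
  | .seq p q, f => by
    rw [LPath.pre, LPath.pre_sat M q f, LPath.pre_exists]
    funext x
    simp only [LPath.pre_sat M p, LPath.dnf, Subtype.exists, List.mem_flatMap, List.mem_map,
      eq_iff_iff]
    constructor
    · rintro ⟨d, hd, d', hd', h⟩
      exact ⟨_, ⟨d', hd', d, hd, rfl⟩, h⟩
    · rintro ⟨_, ⟨d', hd', d, hd, rfl⟩, h⟩
      exact ⟨d, hd, d', hd', h⟩
  | .union p q, f => by
    rw [LPath.pre, LPath.pre_sat M p f, LPath.pre_sat M q f]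
    funext x
    simp [LPath.dnf, or_and_right, exists_or]

theorem LStep.pre_sat (M : Model.{u, v} S) : ∀ (s : LStep S) (f : Formula S),
    s.pre M (f.Sat M) = fun x => ∃ d : {d // d ∈ s.dnf}, (d.1.formula f).Sat M x
  | .base a n, f => by
    have h : (Formula.and n.formula f).Sat M = fun x => n.Holds (M.lab x) ∧ f.Sat M x := by
      funext x
      simp [Formula.Sat, NodeTest.sat_formula]
    funext x
    simp [LStep.pre, LStep.dnf, LStep.formula, Axis.sat_formula, h]
  | .filter s e, f => by
    have h : (fun x => e.pre M x ∧ f.Sat M x) =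
        fun x => ∃ d : {d // d ∈ e.dnf}, (Formula.and d.1.formula f).Sat M x := by
      rw [FExpr.pre_sat M e]
      funext x
      simp [Formula.Sat]
    rw [LStep.pre, h, LStep.pre_exists]
    funext x
    simp only [LStep.pre_sat M s, LStep.dnf, Subtype.exists, List.mem_flatMap, List.mem_map,
      eq_iff_iff]
    constructor
    · rintro ⟨d, hd, d', hd', h⟩
      exact ⟨_, ⟨d', hd', d, hd, rfl⟩, h⟩
    · rintro ⟨_, ⟨d', hd', d, hd, rfl⟩, h⟩
      exact ⟨d, hd, d', hd', h⟩

theorem FExpr.pre_sat (M : Model.{u, v} S) : ∀ e : FExpr S,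
    e.pre M = fun x => ∃ d : {d // d ∈ e.dnf}, d.1.formula.Sat M x
  | .path p => by
    have h := LPath.pre_sat M p .top
    rw [FExpr.pre]
    refine Eq.trans h ?_
    funext x
    simp [FExpr.dnf, FExpr.formula]
  | .or p q => by
    have h := LPath.pre_sat M p .top
    have h' := LPath.pre_sat M q .top
    funext x
    have hx := congrFun h x
    have hx' := congrFun h' x
    refine Eq.trans (congrArg₂ Or hx hx') ?_
    simp [FExpr.dnf, FExpr.formula, or_and_right, exists_or]

end

theorem LPath.pre_true_iff (M : Model.{u, v} S) (p : LPath S) (x : M.V) :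
    p.pre M (fun _ => True) x ↔ ∃ d : {d // d ∈ p.dnf}, (d.1.formula .top).Sat M x :=
  iff_of_eq (congrFun (LPath.pre_sat M p .top) x)

/-! ### Small counterexamples -/

section Small

variable (e : S) (m : ℕ) (M : Model.{u, v} S)

/-- Below a root, the forest `F` satisfies no formula that is not satisfied at `x`, as far as
formulas of size at most `m` without the label `e` are concerned. -/
def Forest.Below (F : Forest S) (x : M.V) : Prop :=
  ∀ g : Formula S, e ∉ g.labels → g.size < m →
    ((∃ n, F.Mem n ∧ g.Sat (forestModel S) n) → ∃ y, M.child x y ∧ g.Sat M y) ∧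
    ((∃ n, F.Mem n ∧ ∃ n', Relation.ReflTransGen (forestModel S).child n n' ∧
      g.Sat (forestModel S) n') → ∃ y, Relation.TransGen M.child x y ∧ g.Sat M y)

variable {e m M}

theorem Forest.Below.sat {F : Forest S} {x : M.V} (h : F.Below e m M x) {a : S}
    (ha : a = e ∨ a = M.lab x) : ∀ g : Formula S, e ∉ g.labels → g.size ≤ m →
      g.Sat (forestModel S) (a, F) → g.Sat M x
  | .top, _, _, _ => trivial
  | .lab b, hg, _, hb => by
    rcases ha with rfl | rfl
    · exact (hg (show a = b from hb)).elim
    · exact hb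
  | .and f g, hg, hm, hs =>
    ⟨h.sat ha f (fun h => hg (.inl h)) (le_trans (Nat.le_add_right _ _) hm) hs.1,
      h.sat ha g (fun h => hg (.inr h)) (le_trans (Nat.le_add_left _ _) hm) hs.2⟩
  | .child g, hg, hm, ⟨n, hn, hs⟩ => (h g hg hm).1 ⟨n, hn, hs⟩
  | .desc g, hg, hm, ⟨n, hn, hs⟩ => by
    obtain ⟨n', h1, h2⟩ := Relation.TransGen.head'_iff.1 hn
    exact (h g hg hm).2 ⟨n', h1, n, h2, hs⟩

theorem Forest.Below.append {F G : Forest S} {x : M.V} (hF : F.Below e m M x)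
    (hG : G.Below e m M x) : (F.append G).Below e m M x := by
  intro g hg hm
  constructor
  · rintro ⟨n, hn, h⟩
    rcases Forest.mem_append.1 hn with hn | hn
    · exact (hF g hg hm).1 ⟨n, hn, h⟩
    · exact (hG g hg hm).1 ⟨n, hn, h⟩
  · rintro ⟨n, hn, h⟩
    rcases Forest.mem_append.1 hn with hn | hn
    · exact (hF g hg hm).2 ⟨n, hn, h⟩
    · exact (hG g hg hm).2 ⟨n, hn, h⟩

theorem Forest.Below.cons {F : Forest S} {x y : M.V} (h : F.Below e m M y) {a : S}
    (ha : a = e ∨ a = M.lab y) (hxy : M.child x y) :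
    (Forest.cons a F .nil).Below e m M x := by
  intro g hg hm
  constructor
  · rintro ⟨n, rfl | hn, hs⟩
    · exact ⟨y, hxy, h.sat ha g hg hm.le hs⟩
    · exact hn.elim
  · rintro ⟨n, rfl | hn, n', hn', hs⟩
    · rcases Relation.ReflTransGen.cases_head hn' with rfl | ⟨k, hk, hn'⟩
      · exact ⟨y, .single hxy, h.sat ha g hg hm.le hs⟩
      · obtain ⟨z, hz, hs⟩ := (h g hg hm).2 ⟨k, hk, n', hn', hs⟩
        exact ⟨z, .head hxy hz, hs⟩
    · exact hn.elim

/-- A tree with a path of `r` vertices labelled `e` put on top of it. -/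
def Node.chain (e : S) (n : Node S) : ℕ → Node S
  | 0 => n
  | r + 1 => (e, .cons (n.chain e r).1 (n.chain e r).2 .nil)

theorem Node.child_chain_succ {n n' : Node S} {r : ℕ} :
    (forestModel S).child (n.chain e (r + 1)) n' ↔ n' = n.chain e r := by
  simp [Node.chain, Forest.Mem]

theorem Node.reflTransGen_chain {n : Node S} {r r' : ℕ} (h : r ≤ r') :
    Relation.ReflTransGen (forestModel S).child (n.chain e r') (n.chain e r) := by
  induction h with
  | refl => rfl
  | step _ ih => exact .head (Node.child_chain_succ.2 rfl) ih

theorem Node.sat_chain_of_le {n : Node S} : ∀ {g : Formula S} {r r' : ℕ}, e ∉ g.labels →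
    g.size < r → r ≤ r' → g.Sat (forestModel S) (n.chain e r) →
      g.Sat (forestModel S) (n.chain e r')
  | .top, _, _, _, _, _, _ => trivial
  | .lab b, r + 1, _, hg, _, _, hb => (hg (show e = b from hb)).elim
  | .and f g, r, r', hg, hm, hr, hs =>
    ⟨sat_chain_of_le (fun h => hg (.inl h)) (lt_of_le_of_lt (Nat.le_add_right _ _) hm) hr hs.1,
      sat_chain_of_le (fun h => hg (.inr h)) (lt_of_le_of_lt (Nat.le_add_left _ _) hm) hr hs.2⟩
  | .child g, r + 1, r' + 1, hg, hm, hr, ⟨k, hk, hs⟩ => by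
    rw [Node.child_chain_succ.1 hk] at hs
    exact ⟨_, Node.child_chain_succ.2 rfl,
      sat_chain_of_le hg (Nat.lt_of_succ_lt_succ hm) (Nat.le_of_succ_le_succ hr) hs⟩
  | .desc g, r + 1, r' + 1, hg, hm, hr, ⟨k, hk, hs⟩ =>
    ⟨k, Relation.TransGen.trans_right (Node.reflTransGen_chain hr) hk, hs⟩

/-- Vertices labelled `e` on a path above a tree are put in place of the inner vertices of a
path of the structure. -/
theorem Forest.Below.chain {n : Node S} {y : M.V} (h : n.2.Below e m M y)
    (hn : n.1 = e ∨ n.1 = M.lab y) {x : M.V} (hxy : Relation.TransGen M.child x y) :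
    ∃ k, (Forest.cons (n.chain e k).1 (n.chain e k).2 .nil).Below e m M x := by
  induction hxy using Relation.TransGen.head_induction_on with
  | single hxy => exact ⟨0, h.cons hn hxy⟩
  | head hxy _ ih =>
    obtain ⟨k, hk⟩ := ih
    exact ⟨k + 1, hk.cons (.inl rfl) hxy⟩

theorem Forest.Below.chain_min {n : Node S} {x : M.V} {k : ℕ}
    (h : (Forest.cons (n.chain e k).1 (n.chain e k).2 .nil).Below e m M x) :
    (Forest.cons (n.chain e (min k m)).1 (n.chain e (min k m)).2 .nil).Below e m M x := by
  rcases le_total k m with hkm | hkm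
  · rwa [min_eq_left hkm]
  rw [min_eq_right hkm]
  intro g hg hm
  constructor
  · rintro ⟨n', rfl | hn, hs⟩
    · exact (h g hg hm).1 ⟨_, .inl rfl, Node.sat_chain_of_le hg hm hkm hs⟩
    · exact hn.elim
  · rintro ⟨n', rfl | hn, n'', hn'', hs⟩
    · exact (h g hg hm).2 ⟨_, .inl rfl, n'', (Node.reflTransGen_chain hkm).trans hn'', hs⟩
    · exact hn.elim

theorem Node.size_chain (n : Node S) (r : ℕ) : (n.chain e r).2.size = n.2.size + r := by
  induction r with
  | zero => rfl
  | succ r ih => simp only [Node.chain, Forest.size, ih]; omega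

theorem Node.labels_chain (n : Node S) (r : ℕ) :
    {(n.chain e r).1} ∪ (n.chain e r).2.labels ⊆ {n.1} ∪ n.2.labels ∪ {e} := by
  induction r with
  | zero => exact Set.subset_union_left
  | succ r ih =>
    simp only [Node.chain, Forest.labels, Set.union_empty]
    exact Set.union_subset Set.subset_union_right ih

open Classical in
/-- The label of the root of the tree constructed for a formula that is satisfied at `x`. -/
noncomputable def Formula.rootLabel (e : S) (M : Model.{u, v} S) (f : Formula S) (x : M.V) : S :=
  if f.rootLabels.Nonempty then M.lab x else e

theorem Formula.rootLabel_eq_or (f : Formula S) (x : M.V) :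
    f.rootLabel e M x = e ∨ f.rootLabel e M x = M.lab x := by
  unfold rootLabel
  split_ifs <;> simp

theorem Formula.Sat.rootLabel_eq {f : Formula S} {x : M.V} (h : f.Sat M x) {a : S}
    (ha : a ∈ f.rootLabels) : f.rootLabel e M x = a := by
  rw [rootLabel, if_pos ⟨a, ha⟩, h.lab_eq ha]

theorem Formula.Sat.rootLabel_mem {f : Formula S} {x : M.V} (h : f.Sat M x) :
    f.rootLabel e M x ∈ f.labels ∪ {e} := by
  unfold rootLabel
  split_ifs with hf
  · obtain ⟨a, ha⟩ := hf
    rw [h.lab_eq ha]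
    exact .inl (f.rootLabels_subset ha)
  · exact .inr rfl

theorem Formula.Sat.exists_forest : ∀ {f : Formula S} {x : M.V}, f.Sat M x →
    ∃ F : Forest S, F.size ≤ f.size * (m + 2) ∧ F.labels ⊆ f.labels ∪ {e} ∧ F.Below e m M x ∧
      ∀ N : Node S, (∀ n, F.Mem n → N.2.Mem n) → (∀ a ∈ f.rootLabels, N.1 = a) →
        f.Sat (forestModel S) N
  | .top, x, _ => ⟨.nil, by simp [Forest.size], by simp [Forest.labels],
      fun g _ _ => by simp [Forest.Mem], fun _ _ _ => trivial⟩
  | .lab a, x, _ => ⟨.nil, by simp [Forest.size], by simp [Forest.labels],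
      fun g _ _ => by simp [Forest.Mem], fun _ _ h => h a rfl⟩
  | .and f g, x, h => by
    obtain ⟨F, h1, h2, h3, h4⟩ := h.1.exists_forest
    obtain ⟨G, h1', h2', h3', h4'⟩ := h.2.exists_forest
    refine ⟨F.append G, ?_, ?_, h3.append h3', fun N hN hl => ⟨?_, ?_⟩⟩
    · rw [Forest.size_append, Formula.size, Nat.add_mul]
      exact Nat.add_le_add h1 h1'
    · rw [Forest.labels_append, Formula.labels, Set.union_union_distrib_right]
      exact Set.union_subset_union h2 h2'
    · exact h4 N (fun n hn => hN n (Forest.mem_append.2 (.inl hn))) fun a ha => hl a (.inl ha)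
    · exact h4' N (fun n hn => hN n (Forest.mem_append.2 (.inr hn))) fun a ha => hl a (.inr ha)
  | .child f, x, ⟨y, hxy, h⟩ => by
    obtain ⟨F, h1, h2, h3, h4⟩ := h.exists_forest
    refine ⟨.cons (f.rootLabel e M y) F .nil, ?_, ?_,
      h3.cons (f.rootLabel_eq_or y) hxy, fun N hN _ => ⟨_, hN _ (.inl rfl), ?_⟩⟩
    · simp only [Forest.size, Formula.size, Nat.add_mul]
      omega
    · simp only [Forest.labels, Set.union_empty]
      exact Set.union_subset (Set.singleton_subset_iff.2 h.rootLabel_mem) h2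
    · exact h4 _ (fun n hn => hn) fun a ha => h.rootLabel_eq ha
  | .desc f, x, ⟨y, hxy, h⟩ => by
    obtain ⟨F, h1, h2, h3, h4⟩ := h.exists_forest
    obtain ⟨k, hk⟩ := Forest.Below.chain (n := (f.rootLabel e M y, F)) h3 (f.rootLabel_eq_or y) hxy
    have hsize := Node.size_chain (e := e) (f.rootLabel e M y, F) (min k m)
    have hlab := Node.labels_chain (e := e) (f.rootLabel e M y, F) (min k m)
    have hre := Node.reflTransGen_chain (e := e) (n := (f.rootLabel e M y, F))
      (Nat.zero_le (min k m))
    refine ⟨_, ?_, ?_, hk.chain_min, fun N hN _ => ⟨(f.rootLabel e M y, F),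
      Relation.TransGen.head' (hN _ (.inl rfl)) hre, ?_⟩⟩
    · have := min_le_right k m
      simp only [Forest.size, Formula.size, Nat.add_mul, hsize]
      omega
    · simp only [Forest.labels, Set.union_empty]
      refine hlab.trans (Set.union_subset (Set.union_subset ?_ h2) Set.subset_union_right)
      exact Set.singleton_subset_iff.2 h.rootLabel_mem
    · exact h4 _ (fun n hn => hn) fun a ha => h.rootLabel_eq ha

end Small

/-- A counterexample to a containment can be made small. -/
theorem exists_small_counterexample {p q : LPath S} {n m : ℕ} (hp : ∀ d ∈ p.dnf, d.size ≤ n)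
    (hq : ∀ d ∈ q.dnf, d.size ≤ m) {e : S} (he : e ∉ q.labels) (h : ¬ p.Contained q) :
    ∃ N : Node S, N.2.size ≤ n * (m + 2) ∧ {N.1} ∪ N.2.labels ⊆ p.labels ∪ {e} ∧
      N.Matches p ∧ ¬ N.Matches q := by
  have hsize : ∀ d : LPath S, (d.formula .top).size ≤ d.size := fun d =>
    LPath.size_formula_le d .top
  have hlab : ∀ d : LPath S, (d.formula .top).labels ⊆ d.labels := fun d =>
    (LPath.labels_formula_subset d .top).trans (by simp [Formula.labels])
  simp only [LPath.Contained, not_forall] at h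
  obtain ⟨t, htp, htq⟩ := h
  rw [XMLTree.matches_iff, LPath.pre_true_iff] at htp htq
  obtain ⟨⟨d, hd⟩, hs⟩ := htp
  obtain ⟨F, h1, h2, h3, h4⟩ := hs.exists_forest (e := e) (m := m)
  have hdl : (d.formula .top).labels ∪ {e} ⊆ p.labels ∪ {e} :=
    Set.union_subset_union_left _ ((hlab d).trans (LPath.labels_subset_of_mem_dnf p hd))
  refine ⟨((d.formula .top).rootLabel e t.model t.root, F), ?_, ?_, ?_, ?_⟩
  · exact h1.trans (Nat.mul_le_mul_right _ ((hsize d).trans (hp d hd)))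
  · exact Set.union_subset (Set.singleton_subset_iff.2 (hdl hs.rootLabel_mem)) (h2.trans hdl)
  · exact (LPath.pre_true_iff _ p _).2
      ⟨⟨d, hd⟩, h4 _ (fun n hn => hn) fun a ha => hs.rootLabel_eq ha⟩
  · intro hN
    obtain ⟨⟨d', hd'⟩, hs'⟩ := (LPath.pre_true_iff _ q _).1 hN
    refine htq ⟨⟨d', hd'⟩, h3.sat (Formula.rootLabel_eq_or _ _) _ ?_ ?_ hs'⟩
    · exact fun h => he (LPath.labels_subset_of_mem_dnf q hd' (hlab d' h))
    · exact (hsize d').trans (hq d' hd')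

theorem NodeTest.finite_labels (n : NodeTest S) : n.labels.Finite := by
  cases n
  · exact Set.finite_empty
  · exact Set.finite_singleton _

mutual

theorem LPath.finite_labels : ∀ p : LPath S, p.labels.Finite
  | .step s => LStep.finite_labels s
  | .seq p q => (LPath.finite_labels p).union (LPath.finite_labels q)
  | .union p q => (LPath.finite_labels p).union (LPath.finite_labels q)

theorem LStep.finite_labels : ∀ s : LStep S, s.labels.Finite
  | .base _ n => n.finite_labels
  | .filter s e => (LStep.finite_labels s).union (FExpr.finite_labels e)

theorem FExpr.finite_labels : ∀ e : FExpr S, e.labels.Finite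
  | .path p => LPath.finite_labels p
  | .or p q => (LPath.finite_labels p).union (LPath.finite_labels q)

end

theorem not_contained_iff {p q : LPath S} {n m : ℕ} (hn : 1 ≤ n) (hp : ∀ d ∈ p.dnf, d.size ≤ n)
    (hq : ∀ d ∈ q.dnf, d.size ≤ m) {e : S} (he : e ∉ p.labels ∪ q.labels) :
    ¬ p.Contained q ↔ ∃ t : XMLTree S, t.dom.card ≤ 2 * n * (m + 2) ∧
      (∀ v ∈ t.dom, t.lab v ∈ p.labels ∪ {e}) ∧ t.Matches p ∧ ¬ t.Matches q := by
  constructor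
  · intro h
    obtain ⟨N, h1, h2, h3, h4⟩ := exists_small_counterexample hp hq (fun h => he (.inr h)) h
    refine ⟨N.toTree, ?_, fun v hv => h2 (N.lab_toTree_mem hv), (N.matches_toTree p).2 h3,
      fun h => h4 ((N.matches_toTree q).1 h)⟩
    refine N.card_toTree_le.trans ?_
    have : 1 ≤ n * (m + 2) := Nat.mul_pos hn (by omega)
    rw [Nat.mul_assoc]
    omega
  · rintro ⟨t, -, -, h, h'⟩ hc
    exact h' (hc t h)

end XPathContainment

namespace XPathContainment

/-! ### A structured language for machines with several stacks -/

section Cmd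

variable {K : Type} (Γ : K → Type)

/-- Programs that work on stacks: `pop k f` takes the top symbol from the stack `k` (if there is
one) and continues with the program that `f` assigns to it; `loop k f` does so as long as the
stack `k` is not empty. -/
inductive Cmd
  | skip
  | push (k : K) (a : Γ k)
  | seq (c d : Cmd)
  | pop (k : K) (f : Option (Γ k) → Cmd)
  | loop (k : K) (f : Γ k → Cmd)

variable {Γ}

namespace Cmd

/-- `c.Exec S S' n`: started with the stacks `S`, the program `c` stops with the stacks `S'` after
at most `n` steps. -/
inductive Exec [DecidableEq K] : Cmd Γ → (∀ k, List (Γ k)) → (∀ k, List (Γ k)) → ℕ → Prop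
  | skip {S} : Exec skip S S 1
  | push {S k a} : Exec (push k a) S (Function.update S k (a :: S k)) 1
  | seq {c d S S' S'' m n} : Exec c S S' m → Exec d S' S'' n → Exec (seq c d) S S'' (m + n)
  | pop {k f S S' n} : Exec (f (S k).head?) (Function.update S k (S k).tail) S' n →
      Exec (pop k f) S S' (n + 1)
  | loop_nil {k f S} : S k = [] → Exec (loop k f) S S 1
  | loop_cons {k f S S' S'' a r m n} : S k = a :: r → Exec (f a) (Function.update S k r) S' m →
      Exec (loop k f) S' S'' n → Exec (loop k f) S S'' (m + n + 1)
  | mono {c S S' m n} : Exec c S S' m → m ≤ n → Exec c S S' n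

/-- The control states of the machine for a program. -/
def Lbl : Cmd Γ → Type
  | skip => Unit
  | push _ _ => Unit
  | seq c d => c.Lbl ⊕ d.Lbl
  | pop _ f => Option (Σ o, (f o).Lbl)
  | loop _ f => Option (Σ a, (f a).Lbl)

theorem finite_lbl [∀ k, Finite (Γ k)] : ∀ c : Cmd Γ, Finite c.Lbl
  | skip => inferInstanceAs (Finite Unit)
  | push _ _ => inferInstanceAs (Finite Unit)
  | seq c d =>
    have := c.finite_lbl
    have := d.finite_lbl
    inferInstanceAs (Finite (c.Lbl ⊕ d.Lbl))
  | pop _ f =>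
    have := fun o => (f o).finite_lbl
    inferInstanceAs (Finite (Option (Σ o, (f o).Lbl)))
  | loop _ f =>
    have := fun a => (f a).finite_lbl
    inferInstanceAs (Finite (Option (Σ a, (f a).Lbl)))

/-- The initial control state. -/
def entry : (c : Cmd Γ) → c.Lbl
  | skip => ()
  | push _ _ => ()
  | seq c _ => .inl c.entry
  | pop _ _ => none
  | loop _ _ => none

variable [DecidableEq K]

/-- The statements of the machine for a program; the finite memory holds the symbols that were
popped last. -/
def code {Λ : Type} : (c : Cmd Γ) → (c.Lbl → Λ) → Λ → c.Lbl →
    Turing.TM2.Stmt Γ Λ (∀ k, Option (Γ k))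
  | skip, _, x, _ => .goto fun _ => x
  | push k a, _, x, _ => .push k (fun _ => a) (.goto fun _ => x)
  | seq c d, i, _, .inl l => c.code (i ∘ .inl) (i (.inr d.entry)) l
  | seq _ d, i, x, .inr l => d.code (i ∘ .inr) x l
  | pop k f, i, _, none =>
    .pop k (fun v o => Function.update v k o) (.goto fun v => i (some ⟨v k, (f (v k)).entry⟩))
  | pop _ f, i, x, some ⟨o, l⟩ => (f o).code (fun l => i (some ⟨o, l⟩)) x l
  | loop k f, i, x, none =>
    .pop k (fun v o => Function.update v k o)
      (.goto fun v => (v k).elim x fun a => i (some ⟨a, (f a).entry⟩))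
  | loop _ f, i, _, some ⟨a, l⟩ => (f a).code (fun l => i (some ⟨a, l⟩)) (i none) l

theorem Exec.iterate {c : Cmd Γ} {S S' : ∀ k, List (Γ k)} {n : ℕ} (h : c.Exec S S' n) {Λ : Type}
    (M : Λ → Turing.TM2.Stmt Γ Λ (∀ k, Option (Γ k))) (i : c.Lbl → Λ) (x : Λ)
    (hM : ∀ l, M (i l) = c.code i x l) (v : ∀ k, Option (Γ k)) :
    ∃ j ≤ n, ∃ v', (flip bind (Turing.TM2.step M))^[j] (some ⟨some (i c.entry), v, S⟩) =
      some ⟨some x, v', S'⟩ := by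
  induction h generalizing x v with
  | skip =>
    refine ⟨1, le_rfl, v, ?_⟩
    exact congrArg (fun s => some (Turing.TM2.stepAux s _ _)) (hM ())
  | push =>
    refine ⟨1, le_rfl, v, ?_⟩
    exact congrArg (fun s => some (Turing.TM2.stepAux s _ _)) (hM ())
  | @seq c d S S' S'' m n _ _ ih ih' =>
    obtain ⟨j, hj, v', h⟩ := ih (i ∘ .inl) (i (.inr d.entry)) (fun l => hM (.inl l)) v
    obtain ⟨j', hj', v'', h'⟩ := ih' (i ∘ .inr) x (fun l => hM (.inr l)) v'
    refine ⟨j' + j, by omega, v'', ?_⟩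
    rw [Function.iterate_add_apply]
    exact (congrArg _ h).trans h'
  | @pop k f S S' n _ ih =>
    obtain ⟨j, hj, v', h⟩ := ih (fun l => i (some ⟨_, l⟩)) x (fun l => hM (some ⟨_, l⟩))
      (Function.update v k (S k).head?)
    refine ⟨j + 1, by omega, v', ?_⟩
    rw [Function.iterate_add_apply]
    refine Eq.trans (congrArg _ ?_) h
    refine (congrArg (fun s => some (Turing.TM2.stepAux s _ _)) (hM none)).trans ?_
    have : Function.update v k (S k).head? k = (S k).head? := Function.update_self ..
    simp only [code, Turing.TM2.stepAux]
    generalize Function.update v k (S k).head? k = z at this ⊢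
    subst this
    rfl
  | @loop_nil k f S hS =>
    refine ⟨1, le_rfl, Function.update v k none, ?_⟩
    have : Function.update S k [] = S := by rw [← hS, Function.update_eq_self]
    refine (congrArg (fun s => some (Turing.TM2.stepAux s _ _)) (hM none)).trans ?_
    simp [code, hS, this]
  | @loop_cons k f S S' S'' a r m n hS _ _ ih ih' =>
    obtain ⟨j, hj, v', h⟩ := ih (fun l => i (some ⟨_, l⟩)) (i none) (fun l => hM (some ⟨_, l⟩))
      (Function.update v k (some a))
    obtain ⟨j', hj', v'', h'⟩ := ih' i x hM v'
    refine ⟨j' + (j + 1), by omega, v'', ?_⟩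
    rw [Function.iterate_add_apply, Function.iterate_add_apply]
    refine Eq.trans (congrArg _ (Eq.trans (congrArg _ ?_) h)) h'
    refine (congrArg (fun s => some (Turing.TM2.stepAux s _ _)) (hM none)).trans ?_
    simp [code, hS]
  | mono _ hmn ih =>
    obtain ⟨j, hj, h⟩ := ih i x hM v
    exact ⟨j, hj.trans hmn, h⟩

variable [Fintype K] [∀ k, Fintype (Γ k)]

/-- The machine that executes a program. -/
noncomputable def machine (c : Cmd Γ) (inp out : K) : Turing.FinTM2 where
  K := K
  k₀ := inp
  k₁ := out
  Γ := Γ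
  Λ := Option c.Lbl
  main := some c.entry
  ΛFin := have := c.finite_lbl; Fintype.ofFinite _
  σ := ∀ k, Option (Γ k)
  initialState _ := none
  m
    | none => .load (fun _ _ => none) .halt
    | some l => c.code some none l

theorem initList_machine (c : Cmd Γ) (inp out : K) (l : List (Γ inp)) :
    Turing.initList (c.machine inp out) l =
      ⟨some (some c.entry), fun _ => none, Function.update (fun _ => []) inp l⟩ := by
  unfold Turing.initList
  congr 1
  refine funext fun (k : K) => ?_
  by_cases hk : k = inp
  · subst hk
    have : Function.update (fun k => ([] : List (Γ k))) k l k = l := Function.update_self ..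
    exact (dif_pos rfl).trans this.symm
  · have : Function.update (fun k => ([] : List (Γ k))) inp l k = [] := Function.update_of_ne hk ..
    exact (dif_neg hk).trans this.symm

theorem haltList_machine (c : Cmd Γ) (inp out : K) (l : List (Γ out)) :
    Turing.haltList (c.machine inp out) l =
      ⟨none, fun _ => none, Function.update (fun _ => []) out l⟩ := by
  unfold Turing.haltList
  congr 1
  refine funext fun (k : K) => ?_
  by_cases hk : k = out
  · subst hk
    have : Function.update (fun k => ([] : List (Γ k))) k l k = l := Function.update_self ..
    exact (dif_pos rfl).trans this.symm
  · have : Function.update (fun k => ([] : List (Γ k))) out l k = [] := Function.update_of_ne hk ..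
    exact (dif_neg hk).trans this.symm

theorem Exec.outputsInTime {c : Cmd Γ} {inp out : K} {l : List (Γ inp)} {l' : List (Γ out)} {n : ℕ}
    (h : c.Exec (Function.update (fun _ => []) inp l) (Function.update (fun _ => []) out l') n) :
    Nonempty (Turing.TM2OutputsInTime (c.machine inp out) l (some l') (n + 1)) := by
  obtain ⟨j, hj, v, hv⟩ := h.iterate (c.machine inp out).m some none (fun _ => rfl) fun _ => none
  refine ⟨⟨⟨1 + j, ?_⟩, (Nat.add_comm 1 j).trans_le (Nat.add_le_add_right hj 1)⟩⟩
  rw [Function.iterate_add_apply, initList_machine]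
  refine Eq.trans (congrArg _ hv) ?_
  exact (congrArg some (haltList_machine c inp out l')).symm

end Cmd

end Cmd

/-! ### The verifier: stacks and programs -/

/-- The symbols of certificates, which are trees written as words. -/
inductive Cert
  | bit (b : Bool)
  | node
  | close
  deriving Fintype

/-- The symbols of the tape, which holds a tree whose vertices are marked. -/
inductive TapeSym
  | bit (b : Bool)
  | node (m : Bool)
  | close
  deriving Fintype

/-- Operations on sets of vertices: the current set is given by the marks on the tape, and other
sets are kept on a stack. -/
inductive Op
  | save (all : Bool)
  | swap
  | combine (g : Bool → Bool → Bool)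
  | bit (b : Bool)
  | test
  | axis (d : Bool)
  deriving Fintype

/-- The symbols of the parser: nonterminals, and symbols that are to be written. -/
inductive Pend
  | path
  | step
  | filt
  | test
  | bits
  | tree
  | kids
  | op (o : Op)
  | tape (x : TapeSym)
  deriving Fintype

/-- The stacks of the verifier. -/
inductive Stk
  | inp
  | pend
  | code
  | front
  | back
  | acc
  | saved
  | lb
  | lb'
  | flag
  | out
  deriving DecidableEq

instance : Fintype Stk where
  elems := {.inp, .pend, .code, .front, .back, .acc, .saved, .lb, .lb', .flag, .out}
  complete x := by cases x <;> decide

abbrev Stk.Sym : Stk → Type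
  | inp => Tok ⊕ Cert
  | pend => Pend
  | code => Op
  | front => TapeSym
  | back => TapeSym
  | acc => Bool
  | saved => Bool
  | lb => Bool
  | lb' => Bool
  | flag => Bool
  | out => Bool

instance : ∀ k : Stk, Fintype k.Sym
  | .inp => inferInstanceAs (Fintype (Tok ⊕ Cert))
  | .pend => inferInstanceAs (Fintype Pend)
  | .code => inferInstanceAs (Fintype Op)
  | .front => inferInstanceAs (Fintype TapeSym)
  | .back => inferInstanceAs (Fintype TapeSym)
  | .acc => inferInstanceAs (Fintype Bool)
  | .saved => inferInstanceAs (Fintype Bool)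
  | .lb => inferInstanceAs (Fintype Bool)
  | .lb' => inferInstanceAs (Fintype Bool)
  | .flag => inferInstanceAs (Fintype Bool)
  | .out => inferInstanceAs (Fintype Bool)

/-- The contents of the stacks. -/
structure Store where
  inp : List (Tok ⊕ Cert) := []
  pend : List Pend := []
  code : List Op := []
  front : List TapeSym := []
  back : List TapeSym := []
  acc : List Bool := []
  saved : List Bool := []
  lb : List Bool := []
  lb' : List Bool := []
  flag : List Bool := []
  out : List Bool := []

namespace Store

def get (s : Store) : ∀ k : Stk, List k.Sym
  | .inp => s.inp
  | .pend => s.pend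
  | .code => s.code
  | .front => s.front
  | .back => s.back
  | .acc => s.acc
  | .saved => s.saved
  | .lb => s.lb
  | .lb' => s.lb'
  | .flag => s.flag
  | .out => s.out

def set (s : Store) : ∀ k : Stk, List k.Sym → Store
  | .inp, l => {s with inp := l}
  | .pend, l => {s with pend := l}
  | .code, l => {s with code := l}
  | .front, l => {s with front := l}
  | .back, l => {s with back := l}
  | .acc, l => {s with acc := l}
  | .saved, l => {s with saved := l}
  | .lb, l => {s with lb := l}
  | .lb', l => {s with lb' := l}
  | .flag, l => {s with flag := l}
  | .out, l => {s with out := l}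

theorem get_set (s : Store) (k : Stk) (l : List k.Sym) :
    (s.set k l).get = Function.update s.get k l := by
  funext k'
  cases k <;> cases k' <;> rfl

end Store

abbrev Prog := Cmd Stk.Sym

/-- Execution of a program of the verifier. -/
def Ex (c : Prog) (s s' : Store) (n : ℕ) : Prop := c.Exec s.get s'.get n

namespace Ex

variable {c d : Prog} {s s' s'' : Store} {m n N : ℕ} {k : Stk}

theorem mono (h : Ex c s s' m) (hmn : m ≤ n) : Ex c s s' n := Cmd.Exec.mono h hmn

theorem skip : Ex .skip s s 1 := Cmd.Exec.skip

theorem push {a : k.Sym} : Ex (.push k a) s (s.set k (a :: s.get k)) 1 := by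
  unfold Ex
  rw [Store.get_set]
  exact Cmd.Exec.push

theorem seq (h : Ex c s s' m) (h' : Ex d s' s'' n) : Ex (.seq c d) s s'' (m + n) :=
  Cmd.Exec.seq h h'

theorem pop {f : Option k.Sym → Prog} (h : Ex (f (s.get k).head?) (s.set k (s.get k).tail) s' n) :
    Ex (.pop k f) s s' (n + 1) := by
  unfold Ex at h
  rw [Store.get_set] at h
  exact Cmd.Exec.pop h

theorem loop_nil {f : k.Sym → Prog} (h : s.get k = []) : Ex (.loop k f) s s 1 :=
  Cmd.Exec.loop_nil h

theorem loop_cons {f : k.Sym → Prog} {a : k.Sym} {r : List k.Sym} (h : s.get k = a :: r)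
    (hb : Ex (f a) (s.set k r) s' m) (hr : Ex (.loop k f) s' s'' n) (hN : m + n + 1 ≤ N) :
    Ex (.loop k f) s s'' N := by
  unfold Ex at hb
  rw [Store.get_set] at hb
  exact (Cmd.Exec.loop_cons h hb hr).mono hN

theorem drain {f : k.Sym → Prog} (hf : ∀ a, f a = .skip) (s : Store) (l : List k.Sym) :
    Ex (.loop k f) (s.set k l) (s.set k []) (2 * l.length + 1) := by
  have h1 : ∀ l, (s.set k l).get k = l := fun l => by simp [Store.get_set]
  have h2 : ∀ l l', (s.set k l).set k l' = s.set k l' := by cases k <;> intros <;> rfl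
  induction l with
  | nil => exact loop_nil (h1 _)
  | cons a l ih =>
    refine loop_cons (h1 _) ?_ ih (m := 1) (by simp only [List.length_cons]; omega)
    rw [hf, h2]
    exact skip

end Ex

namespace Prog

open Cmd

def drain (k : Stk) : Prog := loop k fun _ => skip

/-- The program that replaces the contents of the stacks by the result. -/
def finish (b : Bool) : Prog :=
  seq (drain .inp) <| seq (drain .pend) <| seq (drain .code) <| seq (drain .front) <|
  seq (drain .back) <| seq (drain .acc) <| seq (drain .saved) <| seq (drain .lb) <|
  seq (drain .lb') <| seq (drain .flag) <| push .out b

def setFlag (b : Bool) : Prog := pop .flag fun _ => push .flag b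

def restore : Prog := seq (loop .lb' fun x => push .lb x) (push .flag true)

/-- The pass over the tape from right to left. -/
def backward : Op → TapeSym → Prog
  | .combine g, .node m => pop .saved fun b => push .front (.node (g m (b.getD false)))
  | .swap, .node m => pop .saved fun b =>
      seq (push .front (.node (b.getD false))) (push .lb' m)
  | .axis _, .close => seq (push .acc false) (push .front .close)
  | .axis d, .node m => pop .acc fun e => pop .acc fun e' =>
      seq (push .acc (e'.getD false || (m || (d && e.getD false))))
        (push .front (.node (e.getD false)))
  | _, x => push .front x

/-- The pass over the tape from left to right. -/
def forward : Op → TapeSym → Prog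
  | .save all, .node m => seq (push .saved m) (push .back (.node (m || all)))
  | .test, .bit b => seq (push .back (.bit b)) (pop .lb fun
      | none => setFlag false
      | some x => seq (push .lb' x) (if x = b then skip else setFlag false))
  | .test, .node m => pop .flag fun fl => pop .lb fun
      | none => seq (push .back (.node (m && fl.getD false))) restore
      | some x => seq (push .lb x) (seq (push .back (.node false)) restore)
  | _, x => push .back x

def passes (o : Op) : Prog := seq (loop .back (backward o)) (loop .front (forward o))

def op : Op → Prog
  | .bit b => push .lb b
  | .axis d => seq (push .acc false) (seq (passes (.axis d)) (drain .acc))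
  | .swap => seq (passes .swap) (loop .lb' fun m => push .saved m)
  | .test => seq (push .flag true) (seq (passes .test) (seq (drain .flag) (drain .lb)))
  | o => passes o

def pushAll : List Pend → Prog
  | [] => skip
  | x :: l => seq (pushAll l) (push .pend x)

end Prog

/-- The trees of a forest as a word in which the vertices in `X` are marked. -/
noncomputable def Forest.tape (X : Node (List Bool) → Prop) : Forest (List Bool) → List TapeSym
  | .nil => []
  | .cons a k s =>
    a.map .bit ++ .node (@decide (X (a, k)) (Classical.propDecidable _)) :: (k.tape X ++
      .close :: s.tape X)

/-- The marks of the vertices in document order. -/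
noncomputable def Forest.marks (X : Node (List Bool) → Prop) : Forest (List Bool) → List Bool
  | .nil => []
  | .cons a k s =>
    @decide (X (a, k)) (Classical.propDecidable _) :: (k.marks X ++ s.marks X)

theorem Forest.length_tape (X Y : Node (List Bool) → Prop) (f : Forest (List Bool)) :
    (f.tape X).length = (f.tape Y).length := by
  induction f with
  | nil => rfl
  | cons a k s ihk ihs => simp [tape, ihk, ihs]

theorem Forest.length_marks_le (X Y : Node (List Bool) → Prop) (f : Forest (List Bool)) :
    (f.marks X).length ≤ (f.tape Y).length := by
  induction f with
  | nil => exact le_rfl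
  | cons a k s ihk ihs =>
    simp only [tape, marks, List.length_append, List.length_cons, List.length_map]
    omega

namespace Prog

open Cmd

variable {o : Op} {s t : Store} {n N : ℕ}

theorem backward_copy (l : List TapeSym) (hl : ∀ x ∈ l, backward o x = push .front x)
    {rest fr : List TapeSym}
    (h : Ex (loop .back (backward o)) {s with back := rest, front := l.reverse ++ fr} t n)
    (hN : n + 2 * l.length ≤ N) :
    Ex (loop .back (backward o)) {s with back := l ++ rest, front := fr} t N := by
  induction l generalizing fr N with
  | nil => exact h.mono hN
  | cons x l ih =>
    refine Ex.loop_cons (a := x) (r := l ++ rest) (m := 1) (n := n + 2 * l.length) rfl ?_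
      (ih (fr := x :: fr) (fun y hy => hl y (.tail _ hy)) (by simpa using h) le_rfl)
      (by simp only [List.length_cons] at hN; omega)
    rw [hl x (.head _)]
    exact Ex.push

theorem forward_copy (l : List TapeSym) (hl : ∀ x ∈ l, forward o x = push .back x)
    {rest ba : List TapeSym}
    (h : Ex (loop .front (forward o)) {s with front := rest, back := l.reverse ++ ba} t n)
    (hN : n + 2 * l.length ≤ N) :
    Ex (loop .front (forward o)) {s with front := l ++ rest, back := ba} t N := by
  induction l generalizing ba N with
  | nil => exact h.mono hN
  | cons x l ih =>
    refine Ex.loop_cons (a := x) (r := l ++ rest) (m := 1) (n := n + 2 * l.length) rfl ?_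
      (ih (ba := x :: ba) (fun y hy => hl y (.tail _ hy)) (by simpa using h) le_rfl)
      (by simp only [List.length_cons] at hN; omega)
    rw [hl x (.head _)]
    exact Ex.push

theorem backward_bits (o : Op) (a : List Bool) {rest fr : List TapeSym}
    (h : Ex (loop .back (backward o)) {s with back := rest, front := a.map .bit ++ fr} t n) :
    Ex (loop .back (backward o)) {s with back := (a.map .bit).reverse ++ rest, front := fr} t
      (n + 2 * a.length) := by
  refine backward_copy _ (fun x hx => ?_) (n := n) (by simpa using h) (by simp)
  obtain ⟨b, -, rfl⟩ := List.mem_map.1 (List.mem_reverse.1 hx)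
  cases o <;> rfl

theorem forward_bits (a : List Bool) (ho : ∀ b, forward o (.bit b) = push .back (.bit b))
    {rest ba : List TapeSym}
    (h : Ex (loop .front (forward o)) {s with front := rest, back := (a.map .bit).reverse ++ ba}
      t n) :
    Ex (loop .front (forward o)) {s with front := a.map .bit ++ rest, back := ba} t
      (n + 2 * a.length) := by
  refine forward_copy _ (fun x hx => ?_) (n := n) h (by simp)
  obtain ⟨b, -, rfl⟩ := List.mem_map.1 hx
  exact ho b

theorem tape_reverse_cons (X : Node (List Bool) → Prop) (a : List Bool)
    (k f : Forest (List Bool)) (rest : List TapeSym) :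
    ((Forest.cons a k f).tape X).reverse ++ rest = (f.tape X).reverse ++ .close ::
      ((k.tape X).reverse ++ .node (@decide (X (a, k)) (Classical.propDecidable _)) ::
        ((a.map .bit).reverse ++ rest)) := by
  simp [Forest.tape]

theorem backward_combine (g : Bool → Bool → Bool) (X Y Z : Node (List Bool) → Prop)
    (hZ : ∀ u, @decide (Z u) (Classical.propDecidable _) =
      g (@decide (X u) (Classical.propDecidable _)) (@decide (Y u) (Classical.propDecidable _)))
    (f : Forest (List Bool)) : ∀ {rest fr : List TapeSym} {sv : List Bool} {n N : ℕ},
    Ex (loop .back (backward (.combine g)))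
      {s with back := rest, front := f.tape Z ++ fr, saved := sv} t n →
    n + 4 * (f.tape X).length ≤ N →
    Ex (loop .back (backward (.combine g)))
      {s with back := (f.tape X).reverse ++ rest, front := fr,
              saved := (f.marks Y).reverse ++ sv} t N := by
  induction f with
  | nil => exact fun h hN => h.mono hN
  | cons a k f ihk ihf =>
    intro rest fr sv n N h hN
    have hm : ((Forest.cons a k f).marks Y).reverse ++ sv = (f.marks Y).reverse ++
        ((k.marks Y).reverse ++ @decide (Y (a, k)) (Classical.propDecidable _) :: sv) := by
      simp [Forest.marks]
    rw [tape_reverse_cons, hm]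
    simp only [Forest.tape, List.length_append, List.length_cons, List.length_map] at hN
    refine ihf (n := n + 4 * (a.length + 1 + (k.tape X).length) + 2) ?_ (by omega)
    refine Ex.loop_cons (m := 1) (n := n + 4 * (a.length + 1 + (k.tape X).length))
      (s' := {s with back := _, front := .close :: (f.tape Z ++ fr), saved := _}) rfl Ex.push ?_
      (by omega)
    refine ihk (n := n + 4 * (a.length + 1)) ?_ (by omega)
    refine Ex.loop_cons (m := 2) (n := n + 2 * a.length)
      (s' := {s with back := (a.map .bit).reverse ++ rest, saved := sv,
                     front := .node (g (@decide (X (a, k)) (Classical.propDecidable _))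
                       (@decide (Y (a, k)) (Classical.propDecidable _))) ::
                         (k.tape Z ++ .close :: (f.tape Z ++ fr))})
      rfl (Ex.pop Ex.push) ?_ (by omega)
    refine backward_bits (.combine g) (s := {s with saved := sv}) a ?_
    simpa [Forest.tape, hZ] using h

theorem backward_swap (X Y : Node (List Bool) → Prop)
    (f : Forest (List Bool)) : ∀ {rest fr : List TapeSym} {sv l : List Bool} {n N : ℕ},
    Ex (loop .back (backward .swap))
      {s with back := rest, front := f.tape Y ++ fr, saved := sv, lb' := f.marks X ++ l} t n →
    n + 5 * (f.tape X).length ≤ N →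
    Ex (loop .back (backward .swap))
      {s with back := (f.tape X).reverse ++ rest, front := fr,
              saved := (f.marks Y).reverse ++ sv, lb' := l} t N := by
  induction f with
  | nil => exact fun h hN => h.mono hN
  | cons a k f ihk ihf =>
    intro rest fr sv l n N h hN
    have hm : ((Forest.cons a k f).marks Y).reverse ++ sv = (f.marks Y).reverse ++
        ((k.marks Y).reverse ++ @decide (Y (a, k)) (Classical.propDecidable _) :: sv) := by
      simp [Forest.marks]
    rw [tape_reverse_cons, hm]
    simp only [Forest.tape, List.length_append, List.length_cons, List.length_map] at hN
    refine ihf (n := n + 5 * (a.length + 1 + (k.tape X).length) + 2) ?_ (by omega)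
    refine Ex.loop_cons (m := 1) (n := n + 5 * (a.length + 1 + (k.tape X).length))
      (s' := {s with back := _, front := .close :: (f.tape Y ++ fr), saved := _,
                     lb' := f.marks X ++ l}) rfl Ex.push ?_ (by omega)
    refine ihk (n := n + 5 * (a.length + 1)) ?_ (by omega)
    refine Ex.loop_cons (m := 3) (n := n + 2 * a.length)
      (s' := {s with back := (a.map .bit).reverse ++ rest, saved := sv,
                     front := .node (@decide (Y (a, k)) (Classical.propDecidable _)) ::
                       (k.tape Y ++ .close :: (f.tape Y ++ fr)),
                     lb' := @decide (X (a, k)) (Classical.propDecidable _) ::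
                       (k.marks X ++ (f.marks X ++ l))})
      rfl (Ex.pop (Ex.seq Ex.push Ex.push)) ?_ (by omega)
    refine backward_bits .swap (s := {s with saved := sv, lb' := _}) a ?_
    simpa [Forest.tape, Forest.marks] using h

theorem forward_save (all : Bool) (X Z : Node (List Bool) → Prop)
    (hZ : ∀ u, @decide (Z u) (Classical.propDecidable _) =
      (@decide (X u) (Classical.propDecidable _) || all))
    (f : Forest (List Bool)) : ∀ {rest ba : List TapeSym} {sv : List Bool} {n N : ℕ},
    Ex (loop .front (forward (.save all)))
      {s with front := rest, back := (f.tape Z).reverse ++ ba,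
              saved := (f.marks X).reverse ++ sv} t n →
    n + 4 * (f.tape X).length ≤ N →
    Ex (loop .front (forward (.save all)))
      {s with front := f.tape X ++ rest, back := ba, saved := sv} t N := by
  induction f with
  | nil => exact fun h hN => h.mono hN
  | cons a k f ihk ihf =>
    intro rest ba sv n N h hN
    simp only [Forest.tape, List.length_append, List.length_cons, List.length_map] at hN
    simp only [Forest.tape, List.append_assoc, List.cons_append]
    refine Ex.mono (forward_bits (o := .save all) (s := {s with saved := sv}) a (fun _ => rfl)
      (n := n + 4 * ((k.tape X).length + (f.tape X).length) + 6) ?_) (by omega)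
    refine Ex.loop_cons (m := 2) (n := n + 4 * ((k.tape X).length + (f.tape X).length) + 3)
      (s' := {s with front := k.tape X ++ .close :: (f.tape X ++ rest),
                     back := .node (@decide (X (a, k)) (Classical.propDecidable _) || all) ::
                       ((a.map .bit).reverse ++ ba),
                     saved := @decide (X (a, k)) (Classical.propDecidable _) :: sv})
      rfl (Ex.seq Ex.push Ex.push) ?_ (by omega)
    refine ihk (n := n + 4 * (f.tape X).length + 2) ?_ (by omega)
    refine Ex.loop_cons (m := 1) (n := n + 4 * (f.tape X).length)
      (s' := {s with front := f.tape X ++ rest,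
                     back := .close :: ((k.tape Z).reverse ++
                       .node (@decide (X (a, k)) (Classical.propDecidable _) || all) ::
                         ((a.map .bit).reverse ++ ba)),
                     saved := (k.marks X).reverse ++
                       @decide (X (a, k)) (Classical.propDecidable _) :: sv}) rfl Ex.push ?_
      (by omega)
    refine ihf (n := n) ?_ le_rfl
    simpa [Forest.tape, Forest.marks, hZ] using h

/-- The axis that an operation `Op.axis d` evaluates. -/
def _root_.XPathContainment.Op.toAxis (d : Bool) : Axis := if d then .descendant else .child

theorem pre_toAxis (d : Bool) (X : Node (List Bool) → Prop) (u : Node (List Bool)) :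
    (Op.toAxis d).pre (forestModel _) X u ↔ ∃ v, u.2.Mem v ∧
      (X v ∨ d = true ∧ (Op.toAxis d).pre (forestModel _) X v) := by
  cases d with
  | false => simp [Op.toAxis, Axis.pre]
  | true =>
    simp only [Op.toAxis, Axis.pre, if_true]
    constructor
    · rintro ⟨w, h, hX⟩
      obtain ⟨v, hv, h⟩ := Relation.TransGen.head'_iff.1 h
      rcases Relation.reflTransGen_iff_eq_or_transGen.1 h with rfl | h
      · exact ⟨_, hv, .inl hX⟩
      · exact ⟨v, hv, .inr ⟨trivial, w, h, hX⟩⟩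
    · rintro ⟨v, hv, hX | ⟨-, w, h, hX⟩⟩
      · exact ⟨v, .single hv, hX⟩
      · exact ⟨w, .head hv h, hX⟩

open Classical in
theorem backward_axis (d : Bool) (X : Node (List Bool) → Prop)
    (f : Forest (List Bool)) : ∀ {rest fr : List TapeSym} {e : Bool} {acc : List Bool} {n N : ℕ},
    Ex (loop .back (backward (.axis d)))
      {s with back := rest, front := f.tape ((Op.toAxis d).pre (forestModel _) X) ++ fr,
              acc := (e || decide (∃ v, f.Mem v ∧ (X v ∨ d = true ∧
                (Op.toAxis d).pre (forestModel _) X v))) :: acc} t n →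
    n + 8 * (f.tape X).length ≤ N →
    Ex (loop .back (backward (.axis d)))
      {s with back := (f.tape X).reverse ++ rest, front := fr, acc := e :: acc} t N := by
  induction f with
  | nil =>
    intro rest fr e acc n N h hN
    simp only [Forest.Mem, false_and, exists_false, decide_false, Bool.or_false] at h
    exact h.mono hN
  | cons a k f ihk ihf =>
    intro rest fr e acc n N h hN
    rw [tape_reverse_cons]
    simp only [Forest.tape, List.length_append, List.length_cons, List.length_map] at hN
    refine ihf (n := n + 8 * (a.length + 1 + (k.tape X).length) + 3) ?_ (by omega)
    refine Ex.loop_cons (m := 2) (n := n + 8 * (a.length + 1 + (k.tape X).length))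
      (s' := {s with back := _, front := .close :: (f.tape _ ++ fr), acc := false :: _ :: acc})
      rfl (Ex.seq Ex.push Ex.push) ?_ (by omega)
    refine ihk (n := n + 8 * (a.length + 1)) (e := false) ?_ (by omega)
    refine Ex.loop_cons (m := 4) (n := n + 2 * a.length)
      (s' := {s with back := (a.map .bit).reverse ++ rest,
                     front := .node (false || decide (∃ v, k.Mem v ∧
                       (X v ∨ d = true ∧ (Op.toAxis d).pre (forestModel _) X v))) ::
                         (k.tape ((Op.toAxis d).pre (forestModel _) X) ++
                           .close :: (f.tape ((Op.toAxis d).pre (forestModel _) X) ++ fr)),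
                     acc := ((e || decide (∃ v, f.Mem v ∧
                       (X v ∨ d = true ∧ (Op.toAxis d).pre (forestModel _) X v))) ||
                         (decide (X (a, k)) || (d && (false || decide (∃ v, k.Mem v ∧
                           (X v ∨ d = true ∧ (Op.toAxis d).pre (forestModel _) X v)))))) :: acc})
      rfl (Ex.pop (Ex.pop (Ex.seq Ex.push Ex.push))) ?_ (by omega)
    refine backward_bits (.axis d) (s := {s with acc := _ :: acc}) a ?_
    have hk := pre_toAxis d X (a, k)
    simp only at hk
    have hf : (∃ v, (Forest.cons a k f).Mem v ∧
        (X v ∨ d = true ∧ (Op.toAxis d).pre (forestModel _) X v)) ↔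
        (∃ v, f.Mem v ∧ (X v ∨ d = true ∧ (Op.toAxis d).pre (forestModel _) X v)) ∨
          (X (a, k) ∨ d = true ∧ (Op.toAxis d).pre (forestModel _) X (a, k)) := by
      simp only [Forest.Mem, or_and_right, exists_or, exists_eq_left]
      exact or_comm
    simp only [hf, Forest.tape, Bool.decide_or, Bool.decide_and, Bool.decide_eq_true] at h
    simp only [Bool.false_or, ← hk]
    simpa [Bool.or_assoc] using h

theorem forward_test_bits (a : List Bool) : ∀ {l y : List Bool} {ok : Bool}
    {rest ba : List TapeSym} {n N : ℕ},
    Ex (loop .front (forward .test))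
      {s with front := rest, back := (a.map .bit).reverse ++ ba, lb := l.drop a.length,
              lb' := (l.take a.length).reverse ++ y, flag := [ok && decide (l.take a.length = a)]}
      t n →
    n + 7 * a.length ≤ N →
    Ex (loop .front (forward .test))
      {s with front := a.map .bit ++ rest, back := ba, lb := l, lb' := y, flag := [ok]} t N := by
  induction a with
  | nil =>
    intro l y ok rest ba n N h hN
    simp only [List.map_nil, List.reverse_nil, List.nil_append, List.length_nil, List.drop_zero,
      List.take_zero, decide_true, Bool.and_true] at h
    exact h.mono hN
  | cons b a ih =>
    intro l y ok rest ba n N h hN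
    simp only [List.length_cons] at hN
    cases l with
    | nil =>
      refine Ex.loop_cons (n := n + 7 * a.length)
        (s' := {s with front := a.map .bit ++ rest, back := .bit b :: ba, lb := [], lb' := y,
                       flag := [false]})
        rfl (Ex.seq Ex.push (Ex.pop (Ex.pop Ex.push))) ?_ (by omega)
      refine ih (l := []) (y := y) (ok := false) (ba := .bit b :: ba) (n := n) ?_ le_rfl
      simpa using h
    | cons x l =>
      by_cases hx : x = b
      · subst hx
        refine Ex.loop_cons (m := 1 + (1 + 1 + 1)) (n := n + 7 * a.length)
          (s' := {s with front := a.map .bit ++ rest, back := .bit x :: ba, lb := l,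
                         lb' := x :: y, flag := [ok]})
          rfl (Ex.seq Ex.push (Ex.pop (Ex.seq Ex.push (?_ : Ex (if x = x then _ else _) _ _ _)))) ?_
          (by omega)
        · rw [if_pos rfl]
          exact Ex.skip
        refine ih (l := l) (y := x :: y) (ok := ok) (ba := .bit x :: ba) (n := n) ?_ le_rfl
        simpa using h
      · refine Ex.loop_cons (m := 1 + (1 + (1 + 1) + 1)) (n := n + 7 * a.length)
          (s' := {s with front := a.map .bit ++ rest, back := .bit b :: ba, lb := l,
                         lb' := x :: y, flag := [false]}) rfl
          (Ex.seq Ex.push (Ex.pop (Ex.seq Ex.push (?_ : Ex (if x = b then _ else _) _ _ _)))) ?_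
          (by omega)
        · rw [if_neg hx]
          exact Ex.pop Ex.push
        refine ih (l := l) (y := x :: y) (ok := false) (ba := .bit b :: ba) (n := n) ?_ le_rfl
        simpa [hx] using h

theorem loop_restore (y : List Bool) : ∀ {l : List Bool},
    Ex (loop .lb' fun x => push .lb x) {s with lb := l, lb' := y}
      {s with lb := y.reverse ++ l, lb' := []} (2 * y.length + 1) := by
  induction y with
  | nil => exact Ex.loop_nil rfl
  | cons x y ih =>
    intro l
    refine Ex.loop_cons (m := 1) (n := 2 * y.length + 1)
      (s' := {s with lb := x :: l, lb' := y}) rfl Ex.push ?_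
      (by simp only [List.length_cons]; omega)
    have := ih (l := x :: l)
    simpa using this

open Classical in
theorem forward_test (l : List Bool) (X : Node (List Bool) → Prop)
    (f : Forest (List Bool)) : ∀ {rest ba : List TapeSym} {n N : ℕ},
    Ex (loop .front (forward .test))
      {s with front := rest, back := (f.tape fun u => u.1 = l ∧ X u).reverse ++ ba,
              lb := l, lb' := [], flag := [true]} t n →
    n + 10 * (f.tape X).length ≤ N →
    Ex (loop .front (forward .test))
      {s with front := f.tape X ++ rest, back := ba, lb := l, lb' := [], flag := [true]} t N := by
  induction f with
  | nil => exact fun h hN => h.mono hN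
  | cons a k f ihk ihf =>
    intro rest ba n N h hN
    simp only [Forest.tape, List.length_append, List.length_cons, List.length_map] at hN
    simp only [Forest.tape, List.append_assoc, List.cons_append]
    refine forward_test_bits a (y := []) (ok := true)
      (n := n + 3 * a.length + 10 * ((k.tape X).length + (f.tape X).length + 2)) ?_ (by omega)
    simp only [List.append_nil, Bool.true_and]
    have hrest : Ex (loop .front (forward .test))
        {s with front := k.tape X ++ .close :: (f.tape X ++ rest),
                back := .node (decide (a = l ∧ X (a, k))) :: ((a.map .bit).reverse ++ ba),
                lb := l, lb' := [], flag := [true]} t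
        (n + 10 * ((k.tape X).length + (f.tape X).length) + 2) := by
      refine ihk (n := n + 10 * (f.tape X).length + 2) ?_ (by omega)
      refine Ex.loop_cons (m := 1) (n := n + 10 * (f.tape X).length)
        (s' := {s with front := f.tape X ++ rest,
                       back := .close :: ((k.tape fun u => u.1 = l ∧ X u).reverse ++
                         .node (decide (a = l ∧ X (a, k))) :: ((a.map .bit).reverse ++ ba)),
                       lb := l, lb' := [], flag := [true]}) rfl Ex.push ?_ (by omega)
      refine ihf (n := n) ?_ le_rfl
      simpa [Forest.tape] using h
    have hlen : (l.take a.length).reverse.length ≤ a.length := by simp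
    have hlist : (l.take a.length).reverse.reverse ++ l.drop a.length = l := by simp
    have hre := fun s => loop_restore (s := s) (l := l.drop a.length) (l.take a.length).reverse
    simp only [hlist] at hre
    have hst : ∀ b : Bool, Ex (seq (push .back (.node b)) restore)
        {s with front := k.tape X ++ .close :: (f.tape X ++ rest),
                back := (a.map .bit).reverse ++ ba, lb := l.drop a.length,
                lb' := (l.take a.length).reverse, flag := []}
        {s with front := k.tape X ++ .close :: (f.tape X ++ rest),
                back := .node b :: ((a.map .bit).reverse ++ ba), lb := l, lb' := [],
                flag := [true]} (2 * a.length + 3) := fun b =>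
      Ex.mono (m := 1 + (2 * (l.take a.length).reverse.length + 1 + 1))
        (Ex.seq Ex.push (Ex.seq (hre {s with
          front := k.tape X ++ .close :: (f.tape X ++ rest),
          back := .node b :: ((a.map .bit).reverse ++ ba), flag := []}) Ex.push)) (by omega)
    cases hd : l.drop a.length with
    | nil =>
      have hla : decide (a = l ∧ X (a, k)) =
          (decide (X (a, k)) && decide (l.take a.length = a)) := by
        have : l.take a.length = l := by simpa [hd] using List.take_append_drop a.length l
        rw [this, Bool.decide_and, Bool.and_comm, decide_eq_decide.2 (eq_comm (a := a))]
      rw [hd] at hst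
      rw [hla] at hrest
      exact Ex.loop_cons rfl (Ex.pop (Ex.pop (hst _))) hrest (by omega)
    | cons x r =>
      have hla : decide (a = l ∧ X (a, k)) = false := by
        simp only [decide_eq_false_iff_not, not_and]
        rintro rfl
        simp at hd
      rw [hd] at hst
      rw [hla] at hrest
      exact Ex.loop_cons rfl (Ex.pop (Ex.pop (Ex.seq Ex.push (hst _)))) hrest (by omega)

end Prog

noncomputable def Forest.tapeLen (f : Forest (List Bool)) : ℕ := (f.tape fun _ => True).length

theorem Forest.length_tape_eq (X : Node (List Bool) → Prop) (f : Forest (List Bool)) :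
    (f.tape X).length = f.tapeLen := f.length_tape X _

/-- The contents of the stacks between two operations. -/
noncomputable def Store.resident (f : Forest (List Bool)) (X : Node (List Bool) → Prop)
    (c : List Op) (sv l : List Bool) : Store :=
  {code := c, back := (f.tape X).reverse, saved := sv, lb := l}

namespace Prog

open Cmd

variable {s t : Store} {n N : ℕ}

theorem backward_all {o : Op} (ho : ∀ x, backward o x = push .front x) (l : List TapeSym) :
    Ex (loop .back (backward o)) {s with back := l, front := []}
      {s with back := [], front := l.reverse} (2 * l.length + 1) := by
  have := backward_copy (o := o) (s := s) (t := {s with back := [], front := l.reverse}) (n := 1)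
    (N := 2 * l.length + 1) l (fun x _ => ho x) (rest := []) (fr := [])
    (by simpa using Ex.loop_nil (k := .back) rfl) (by omega)
  simpa using this

theorem forward_all {o : Op} (ho : ∀ x, forward o x = push .back x) (l : List TapeSym) :
    Ex (loop .front (forward o)) {s with front := l, back := []}
      {s with front := [], back := l.reverse} (2 * l.length + 1) := by
  have := forward_copy (o := o) (s := s) (t := {s with front := [], back := l.reverse}) (n := 1)
    (N := 2 * l.length + 1) l (fun x _ => ho x) (rest := []) (ba := [])
    (by simpa using Ex.loop_nil (k := .front) rfl) (by omega)
  simpa using this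

variable (f : Forest (List Bool)) (c : List Op) (sv l : List Bool)

theorem op_save (all : Bool) (X Z : Node (List Bool) → Prop)
    (hZ : ∀ u, Z u ↔ X u ∨ all = true) :
    Ex (op (.save all)) (.resident f X c sv l)
      (.resident f Z c ((f.marks X).reverse ++ sv) l) (8 * (f.tapeLen + 1)) := by
  have h1 := backward_all (o := .save all) (fun _ => rfl) (f.tape X).reverse
    (s := .resident f X c sv l)
  rw [List.reverse_reverse, List.length_reverse] at h1
  have hd : ∀ u, @decide (Z u) (Classical.propDecidable _) =
      (@decide (X u) (Classical.propDecidable _) || all) := fun u => by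
    have := hZ u
    by_cases h : X u <;> cases all <;> simp_all
  have h2 := forward_save (s := .resident f X c sv l)
    (t := .resident f Z c ((f.marks X).reverse ++ sv) l) all X Z
    hd f (rest := []) (ba := []) (sv := sv) (n := 1)
    (by rw [List.append_nil]; exact Ex.loop_nil rfl) le_rfl
  rw [List.append_nil] at h2
  have := f.length_tape_eq X
  exact (h1.seq h2).mono (by omega)

theorem op_combine (g : Bool → Bool → Bool) (X Y Z : Node (List Bool) → Prop)
    (hZ : ∀ u, @decide (Z u) (Classical.propDecidable _) =
      g (@decide (X u) (Classical.propDecidable _)) (@decide (Y u) (Classical.propDecidable _))) :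
    Ex (op (.combine g)) (.resident f X c ((f.marks Y).reverse ++ sv) l)
      (.resident f Z c sv l) (8 * (f.tapeLen + 1)) := by
  have h1 := backward_combine (s := .resident f X c sv l)
    (t := {code := c, front := f.tape Z, saved := sv, lb := l}) g X Y Z hZ f (rest := [])
    (fr := []) (sv := sv) (n := 1) (by rw [List.append_nil]; exact Ex.loop_nil rfl) le_rfl
  rw [List.append_nil] at h1
  have h2 := forward_all (o := .combine g) (fun _ => rfl) (f.tape Z) (s := .resident f X c sv l)
  have := f.length_tape_eq X
  have := f.length_tape_eq Z
  exact (h1.seq h2).mono (by omega)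

theorem loop_unload (y : List Bool) : ∀ {l : List Bool},
    Ex (loop .lb' fun x => push .saved x) {s with saved := l, lb' := y}
      {s with saved := y.reverse ++ l, lb' := []} (2 * y.length + 1) := by
  induction y with
  | nil => exact Ex.loop_nil rfl
  | cons x y ih =>
    intro l
    refine Ex.loop_cons (m := 1) (n := 2 * y.length + 1)
      (s' := {s with saved := x :: l, lb' := y}) rfl Ex.push ?_
      (by simp only [List.length_cons]; omega)
    have := ih (l := x :: l)
    simpa using this

theorem op_swap (X Y : Node (List Bool) → Prop) :
    Ex (op .swap) (.resident f X c ((f.marks Y).reverse ++ sv) l)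
      (.resident f Y c ((f.marks X).reverse ++ sv) l) (10 * (f.tapeLen + 1)) := by
  have h1 := backward_swap (s := .resident f X c sv l)
    (t := {code := c, front := f.tape Y, saved := sv, lb := l, lb' := f.marks X}) X Y f (rest := [])
    (fr := []) (sv := sv) (l := []) (n := 1)
    (by rw [List.append_nil, List.append_nil]; exact Ex.loop_nil rfl) le_rfl
  rw [List.append_nil] at h1
  have h2 := forward_all (o := .swap) (fun _ => rfl) (f.tape Y)
    (s := {code := c, saved := sv, lb := l, lb' := f.marks X})
  have h3 := loop_unload (f.marks X) (s := {code := c, back := (f.tape Y).reverse, lb := l})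
    (l := sv)
  have := f.length_tape_eq X
  have := f.length_tape_eq Y
  have := f.length_marks_le X X
  exact ((h1.seq h2).seq h3).mono (by omega)

theorem op_axis (d : Bool) (X : Node (List Bool) → Prop) :
    Ex (op (.axis d)) (.resident f X c sv l)
      (.resident f ((Op.toAxis d).pre (forestModel _) X) c sv l) (16 * (f.tapeLen + 1)) := by
  have h1 := backward_axis (s := .resident f X c sv l) d X f (e := false) (acc := []) (rest := [])
    (fr := []) (n := 1) (by rw [List.append_nil]; exact Ex.loop_nil rfl) le_rfl
  rw [List.append_nil] at h1
  have h2 := forward_all (o := .axis d) (fun _ => rfl)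
    (f.tape ((Op.toAxis d).pre (forestModel _) X))
    (s := {code := c, saved := sv, lb := l,
           acc := [false || @decide (∃ v, f.Mem v ∧ (X v ∨ d = true ∧
             (Op.toAxis d).pre (forestModel _) X v)) (Classical.propDecidable _)]})
  have h3 := Ex.drain (k := .acc) (f := fun _ => skip) (fun _ => rfl)
    (.resident f ((Op.toAxis d).pre (forestModel _) X) c sv l)
    [false || @decide (∃ v, f.Mem v ∧ (X v ∨ d = true ∧
      (Op.toAxis d).pre (forestModel _) X v)) (Classical.propDecidable _)]
  have := f.length_tape_eq X
  have := f.length_tape_eq ((Op.toAxis d).pre (forestModel _) X)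
  exact (Ex.seq Ex.push (Ex.seq (h1.seq h2) h3)).mono
    (by simp only [List.length_singleton]; omega)

theorem op_test (X : Node (List Bool) → Prop) :
    Ex (op .test) (.resident f X c sv l)
      (.resident f (fun u => u.1 = l ∧ X u) c sv []) (14 * (f.tapeLen + 1) + 2 * l.length) := by
  have h1 := backward_all (o := .test) (fun _ => rfl) (f.tape X).reverse
    (s := {code := c, saved := sv, lb := l, flag := [true]})
  rw [List.reverse_reverse, List.length_reverse] at h1
  have h2 := forward_test (s := .resident f X c sv l)
    (t := {code := c, back := (f.tape fun u => u.1 = l ∧ X u).reverse, saved := sv, lb := l,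
           flag := [true]}) l X f (rest := []) (ba := []) (n := 1)
    (by rw [List.append_nil]; exact Ex.loop_nil rfl) le_rfl
  rw [List.append_nil] at h2
  have h3 := Ex.drain (k := .flag) (f := fun _ => skip) (fun _ => rfl)
    (.resident f (fun u => u.1 = l ∧ X u) c sv l) [true]
  have h4 := Ex.drain (k := .lb) (f := fun _ => skip) (fun _ => rfl)
    (.resident f (fun u => u.1 = l ∧ X u) c sv l) l
  have := f.length_tape_eq X
  exact (Ex.seq Ex.push (Ex.seq (h1.seq h2) (h3.seq h4))).mono
    (by simp only [List.length_singleton]; omega)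

end Prog

/-! ### Expressions as sequences of operations -/

def NodeTest.ops : NodeTest (List Bool) → List Op
  | .wildcard => []
  | .label a => a.reverse.map .bit ++ [.test]

def Axis.ops : Axis → List Op
  | .self => []
  | .child => [.axis false]
  | .descendant => [.axis true]

mutual

/-- The operations that replace the current set by its backward image along a location path. -/
def LPath.ops : LPath (List Bool) → List Op
  | .step s => s.ops
  | .seq p q => q.ops ++ p.ops
  | .union p q => .save false :: (q.ops ++ .swap :: (p.ops ++ [.combine or]))

def LStep.ops : LStep (List Bool) → List Op
  | .base a n => n.ops ++ a.ops
  | .filter s e => .save true :: (e.ops ++ .combine and :: s.ops)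

def FExpr.ops : FExpr (List Bool) → List Op
  | .path p => p.ops
  | .or p q => .save false :: (q.ops ++ .swap :: (p.ops ++ [.combine or]))

end

namespace Prog

open Cmd

variable {f : Forest (List Bool)} {t : Store}

theorem loop_op {X Y : Node (List Bool) → Prop} {o : Op} {c : List Op} {sv sv' l l' : List Bool}
    {m n N : ℕ} (h : Ex (op o) (.resident f X c sv l) (.resident f Y c sv' l') m)
    (ht : Ex (loop .code op) (.resident f Y c sv' l') t n) (hN : m + n + 1 ≤ N) :
    Ex (loop .code op) (.resident f X (o :: c) sv l) t N :=
  Ex.loop_cons rfl h ht hN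

theorem loop_bits (X : Node (List Bool) → Prop) (c : List Op) (sv : List Bool) (bs : List Bool) :
    ∀ {y : List Bool} {n : ℕ}, Ex (loop .code op) (.resident f X c sv (bs.reverse ++ y)) t n →
      Ex (loop .code op) (.resident f X (bs.map .bit ++ c) sv y) t (n + 2 * bs.length) := by
  induction bs with
  | nil => exact fun h => h
  | cons b bs ih =>
    intro y n h
    refine loop_op (l' := b :: y) (m := 1) (n := n + 2 * bs.length) Ex.push (ih ?_)
      (by simp only [List.length_cons]; omega)
    simpa using h

theorem loop_nodeTest (nt : NodeTest (List Bool)) (X : Node (List Bool) → Prop) (c : List Op)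
    (sv : List Bool) {n N : ℕ}
    (h : Ex (loop .code op) (.resident f (fun u => nt.Holds u.1 ∧ X u) c sv []) t n)
    (hN : n + 20 * (f.tapeLen + 1) * nt.ops.length ≤ N) :
    Ex (loop .code op) (.resident f X (nt.ops ++ c) sv []) t N := by
  cases nt with
  | wildcard =>
    have hX : (fun u => NodeTest.wildcard.Holds u.1 ∧ X u) = X := by
      funext u
      simp [NodeTest.Holds]
    rw [hX] at h
    exact h.mono (by simpa [NodeTest.ops] using hN)
  | label a =>
    simp only [NodeTest.ops, List.append_assoc, List.length_append, List.length_map,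
      List.length_reverse, List.length_singleton] at hN ⊢
    have h1 := loop_op (op_test f c sv a X) h le_rfl
    have h2 := loop_bits X (.test :: c) sv a.reverse (y := []) (by simpa using h1)
    refine h2.mono ?_
    simp only [List.length_reverse]
    nlinarith

theorem loop_axis (a : Axis) (X : Node (List Bool) → Prop) (c : List Op) (sv : List Bool)
    {n N : ℕ} (h : Ex (loop .code op) (.resident f (a.pre (forestModel _) X) c sv []) t n)
    (hN : n + 20 * (f.tapeLen + 1) * a.ops.length ≤ N) :
    Ex (loop .code op) (.resident f X (a.ops ++ c) sv []) t N := by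
  cases a with
  | self => exact Ex.mono h (by simpa [Axis.ops] using hN)
  | child =>
    simp only [Axis.ops, List.length_singleton] at hN
    exact loop_op (op_axis f c sv [] false X) h (by omega)
  | descendant =>
    simp only [Axis.ops, List.length_singleton] at hN
    exact loop_op (op_axis f c sv [] true X) h (by omega)

theorem loop_union (P Q X : Node (List Bool) → Prop) (p q : List Op) (c : List Op) (sv : List Bool)
    (hp : ∀ {c sv n N}, Ex (loop .code op) (.resident f P c sv []) t n →
      n + 20 * (f.tapeLen + 1) * p.length ≤ N →
      Ex (loop .code op) (.resident f X (p ++ c) sv []) t N)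
    (hq : ∀ {c sv n N}, Ex (loop .code op) (.resident f Q c sv []) t n →
      n + 20 * (f.tapeLen + 1) * q.length ≤ N →
      Ex (loop .code op) (.resident f X (q ++ c) sv []) t N)
    {n N : ℕ} (h : Ex (loop .code op) (.resident f (fun u => P u ∨ Q u) c sv []) t n)
    (hN : n + 20 * (f.tapeLen + 1) *
      (Op.save false :: (q ++ Op.swap :: (p ++ [.combine or]))).length ≤ N) :
    Ex (loop .code op) (.resident f X
      (Op.save false :: (q ++ Op.swap :: (p ++ [.combine or])) ++ c) sv []) t N := by
  have h1 := loop_op (op_combine f c sv [] or P Q (fun u => P u ∨ Q u)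
    (fun u => by by_cases h1 : P u <;> by_cases h2 : Q u <;> simp [h1, h2])) h le_rfl
  have h2 := hp h1 le_rfl
  have h3 := loop_op (op_swap f (p ++ .combine or :: c) sv [] Q X) h2 le_rfl
  have h4 := hq h3 le_rfl
  have h5 := loop_op (op_save f (q ++ .swap :: (p ++ .combine or :: c)) sv [] false X X
    (by simp)) h4 le_rfl
  simp only [List.cons_append, List.append_assoc, List.nil_append]
  refine h5.mono ?_
  simp only [List.length_cons, List.length_append, List.length_nil] at hN
  nlinarith

mutual

theorem loop_path : ∀ (p : LPath (List Bool)) (X : Node (List Bool) → Prop) {c : List Op}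
    {sv : List Bool} {n N : ℕ},
    Ex (loop .code op) (.resident f (p.pre (forestModel _) X) c sv []) t n →
    n + 20 * (f.tapeLen + 1) * p.ops.length ≤ N →
    Ex (loop .code op) (.resident f X (p.ops ++ c) sv []) t N
  | .step s, X, _, _, _, _, h, hN => loop_step s X h hN
  | .seq p q, X, c, sv, n, N, h, hN => by
    have h1 := loop_path q X (loop_path p _ h le_rfl) le_rfl
    rw [LPath.ops, List.append_assoc]
    refine h1.mono ?_
    simp only [LPath.ops, List.length_append] at hN
    nlinarith
  | .union p q, X, c, sv, n, N, h, hN =>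
    loop_union _ _ X p.ops q.ops c sv (loop_path p X) (loop_path q X) h hN

theorem loop_step : ∀ (p : LStep (List Bool)) (X : Node (List Bool) → Prop) {c : List Op}
    {sv : List Bool} {n N : ℕ},
    Ex (loop .code op) (.resident f (p.pre (forestModel _) X) c sv []) t n →
    n + 20 * (f.tapeLen + 1) * p.ops.length ≤ N →
    Ex (loop .code op) (.resident f X (p.ops ++ c) sv []) t N
  | .base a nt, X, c, sv, n, N, h, hN => by
    have h1 := loop_nodeTest nt X (a.ops ++ c) sv (loop_axis a _ c sv h le_rfl) le_rfl
    rw [LStep.ops, List.append_assoc]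
    refine h1.mono ?_
    simp only [LStep.ops, List.length_append] at hN
    nlinarith
  | .filter s e, X, c, sv, n, N, h, hN => by
    have h1 := loop_step s _ h le_rfl
    have h2 := loop_op (op_combine f (s.ops ++ c) sv [] and (e.pre (forestModel _)) X
      (fun u => e.pre (forestModel _) u ∧ X u)
      (fun u => by by_cases h1 : e.pre (forestModel _) u <;> by_cases h2 : X u <;> simp [h1, h2]))
      h1 le_rfl
    have h3 := loop_filt e h2 le_rfl
    have h4 := loop_op (op_save f (e.ops ++ .combine and :: (s.ops ++ c)) sv [] true X
      (fun _ => True) (by simp)) h3 le_rfl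
    simp only [LStep.ops, List.cons_append, List.append_assoc]
    refine h4.mono ?_
    simp only [LStep.ops, List.length_append, List.length_cons] at hN
    nlinarith

theorem loop_filt : ∀ (e : FExpr (List Bool)) {c : List Op} {sv : List Bool} {n N : ℕ},
    Ex (loop .code op) (.resident f (e.pre (forestModel _)) c sv []) t n →
    n + 20 * (f.tapeLen + 1) * e.ops.length ≤ N →
    Ex (loop .code op) (.resident f (fun _ => True) (e.ops ++ c) sv []) t N
  | .path p, _, _, _, _, h, hN => loop_path p _ h hN
  | .or p q, c, sv, _, _, h, hN =>
    loop_union _ _ _ p.ops q.ops c sv (loop_path p _) (loop_path q _) h hN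

end

/-- The operations that mark the vertices at which `p` is true and `q` is false. -/
def _root_.XPathContainment.diffOps (p q : LPath (List Bool)) : List Op :=
  q.ops ++ .save true :: (p.ops ++ [.combine fun a b => a && !b])

theorem loop_diff (p q : LPath (List Bool)) {n N : ℕ}
    (h : Ex (loop .code op) (.resident f (fun u => u.Matches p ∧ ¬ u.Matches q) [] [] []) t n)
    (hN : n + 20 * (f.tapeLen + 1) * (diffOps p q).length ≤ N) :
    Ex (loop .code op) (.resident f (fun _ => True) (diffOps p q) [] []) t N := by
  have h1 := loop_op (op_combine f [] [] [] (fun a b => a && !b) (fun u => u.Matches p)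
    (fun u => u.Matches q) (fun u => u.Matches p ∧ ¬ u.Matches q)
    (fun u => by by_cases h1 : u.Matches p <;> by_cases h2 : u.Matches q <;> simp [h1, h2]))
    h le_rfl
  have h2 := loop_path p (fun _ => True) h1 le_rfl
  have h3 := loop_op (op_save f (p.ops ++ [.combine fun a b => a && !b]) [] [] true
    (fun u => u.Matches q) (fun _ => True) (by simp)) h2 le_rfl
  have h4 := loop_path q (fun _ => True) h3 le_rfl
  refine h4.mono ?_
  simp only [diffOps, List.length_append, List.length_cons, List.length_nil] at hN
  nlinarith

end Prog

/-! ### Parsing -/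

/-- A forest as a certificate. -/
def Forest.cert : Forest (List Bool) → List Cert
  | .nil => []
  | .cons a k s => a.map .bit ++ .node :: (k.cert ++ .close :: s.cert)

namespace Pend

def ofStep : Tok → Option (List Pend)
  | .filter => some [.step, .op (.combine and), .filt, .op (.save true)]
  | .self => some [.test]
  | .child => some [.op (.axis false), .test]
  | .descendant => some [.op (.axis true), .test]
  | _ => none

def alternatives : List Pend := [.op (.combine or), .path, .op .swap, .path, .op (.save false)]

def ofPath : Tok → Option (List Pend)
  | .seq => some [.path, .path]
  | .union => some alternatives
  | i => ofStep i

def ofFilt : Tok → Option (List Pend)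
  | .or => some alternatives
  | i => ofPath i

/-- The right-hand side by which a nonterminal is replaced when the given symbol is read. -/
def expand : Pend → Tok ⊕ Cert → Option (List Pend)
  | .path, .inl i => ofPath i
  | .step, .inl i => ofStep i
  | .filt, .inl i => ofFilt i
  | .test, .inl .wildcard => some []
  | .test, .inl (.bit b) => some [.op .test, .op (.bit b), .bits]
  | .test, .inl .labelEnd => some [.op .test]
  | .bits, .inl (.bit b) => some [.op (.bit b), .bits]
  | .bits, .inl .labelEnd => some []
  | .tree, .inr (.bit b) => some [.tape (.bit b), .tree]
  | .tree, .inr .node => some [.tape (.node true), .kids]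
  | .kids, .inr (.bit b) => some [.tape (.bit b), .tree, .kids]
  | .kids, .inr .node => some [.tape (.node true), .kids, .kids]
  | .kids, .inr .close => some [.tape .close]
  | _, _ => none

theorem ofPath_of_ofStep {i : Tok} {l : List Pend} (h : ofStep i = some l) :
    ofPath i = some l := by
  cases i <;> simp_all [ofStep, ofPath]

theorem ofFilt_of_ofPath {i : Tok} {l : List Pend} (h : ofPath i = some l) :
    ofFilt i = some l := by
  cases i <;> simp_all [ofStep, ofPath, ofFilt]

theorem length_le_of_expand {X : Pend} {i : Tok ⊕ Cert} {l : List Pend}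
    (h : X.expand i = some l) : l.length ≤ 5 := by
  rcases i with i | i <;> cases X <;> cases i <;>
    simp only [expand, ofPath, ofStep, ofFilt, alternatives, Option.some.injEq,
      reduceCtorEq] at h <;> subst h <;> simp

end Pend

/-- `Phrase X u o t`: the word `u` is derived from the symbol `X`, with the output `o` of
operations and `t` of tape symbols. -/
inductive Phrase : Pend → List (Tok ⊕ Cert) → List Op → List TapeSym → Prop
  | path (p : LPath (List Bool)) : Phrase .path (p.encode.map .inl) p.ops.reverse []
  | step (s : LStep (List Bool)) : Phrase .step (s.encode.map .inl) s.ops.reverse []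
  | filt (e : FExpr (List Bool)) : Phrase .filt (e.encode.map .inl) e.ops.reverse []
  | test (n : NodeTest (List Bool)) : Phrase .test (n.encode.map .inl) n.ops.reverse []
  | bits (a : List Bool) : Phrase .bits ((a.map Tok.bit ++ [Tok.labelEnd]).map .inl) (a.map .bit) []
  | tree (a : List Bool) (k : Forest (List Bool)) :
      Phrase .tree ((Forest.cons a k .nil).cert.map .inr) []
        ((Forest.cons a k .nil).tape fun _ => True)
  | kids (k : Forest (List Bool)) :
      Phrase .kids ((k.cert ++ [Cert.close]).map .inr) [] (k.tape (fun _ => True) ++ [.close])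
  | op (o : Op) : Phrase (.op o) [] [o] []
  | tape (x : TapeSym) : Phrase (.tape x) [] [] [x]

inductive Phrases : List Pend → List (Tok ⊕ Cert) → List Op → List TapeSym → Prop
  | nil : Phrases [] [] [] []
  | cons {X : Pend} {l : List Pend} {u u' : List (Tok ⊕ Cert)} {o o' : List Op}
      {t t' : List TapeSym} : Phrase X u o t → Phrases l u' o' t' →
      Phrases (X :: l) (u ++ u') (o ++ o') (t ++ t')

theorem Phrases.append_iff {l l' : List Pend} {u : List (Tok ⊕ Cert)} {o : List Op}
    {t : List TapeSym} : Phrases (l ++ l') u o t ↔ ∃ u₁ u₂ o₁ o₂ t₁ t₂, u = u₁ ++ u₂ ∧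
      o = o₁ ++ o₂ ∧ t = t₁ ++ t₂ ∧ Phrases l u₁ o₁ t₁ ∧ Phrases l' u₂ o₂ t₂ := by
  induction l generalizing u o t with
  | nil =>
    constructor
    · exact fun h => ⟨_, _, _, _, _, _, rfl, rfl, rfl, .nil, h⟩
    · rintro ⟨_, _, _, _, _, _, rfl, rfl, rfl, ⟨⟩, h⟩
      exact h
  | cons X l ih =>
    constructor
    · rintro (_ | ⟨h, h'⟩)
      obtain ⟨_, _, _, _, _, _, rfl, rfl, rfl, h₁, h₂⟩ := ih.1 h'
      exact ⟨_, _, _, _, _, _, (List.append_assoc ..).symm, (List.append_assoc ..).symm,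
        (List.append_assoc ..).symm, .cons h h₁, h₂⟩
    · rintro ⟨_, _, _, _, _, _, rfl, rfl, rfl, h, h₂⟩
      obtain _ | ⟨h, h₁⟩ := h
      simp only [List.append_assoc]
      exact .cons h (ih.2 ⟨_, _, _, _, _, _, rfl, rfl, rfl, h₁, h₂⟩)

theorem Phrases.singleton {X : Pend} {u : List (Tok ⊕ Cert)} {o : List Op} {t : List TapeSym}
    (h : Phrase X u o t) : Phrases [X] u o t := by
  simpa using Phrases.cons h .nil

theorem Phrase.of_ofStep {i : Tok} {l : List Pend} {u : List (Tok ⊕ Cert)} {o : List Op}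
    {t : List TapeSym} (h : Pend.ofStep i = some l) (hl : Phrases l u o t) :
    ∃ s : LStep (List Bool), .inl i :: u = s.encode.map .inl ∧ o = s.ops.reverse ∧ t = [] := by
  cases i <;> simp only [Pend.ofStep, Option.some.injEq, reduceCtorEq] at h <;> subst h
  · obtain _ | ⟨⟨⟩, _ | ⟨⟨⟩, _ | ⟨⟨⟩, _ | ⟨⟨⟩, ⟨⟩⟩⟩⟩⟩ := hl
    rename_i s e
    exact ⟨.filter s e, by simp [LStep.encode], by simp [LStep.ops], rfl⟩
  · obtain _ | ⟨⟨⟩, ⟨⟩⟩ := hl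
    rename_i n
    exact ⟨.base .self n, by simp [LStep.encode, Axis.encode], by simp [LStep.ops, Axis.ops], rfl⟩
  · obtain _ | ⟨⟨⟩, _ | ⟨⟨⟩, ⟨⟩⟩⟩ := hl
    rename_i n
    exact ⟨.base .child n, by simp [LStep.encode, Axis.encode], by simp [LStep.ops, Axis.ops],
      rfl⟩
  · obtain _ | ⟨⟨⟩, _ | ⟨⟨⟩, ⟨⟩⟩⟩ := hl
    rename_i n
    exact ⟨.base .descendant n, by simp [LStep.encode, Axis.encode],
      by simp [LStep.ops, Axis.ops], rfl⟩

theorem Phrases.of_alternatives {u : List (Tok ⊕ Cert)} {o : List Op} {t : List TapeSym}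
    (h : Phrases Pend.alternatives u o t) : ∃ p q : LPath (List Bool),
      u = (p.encode ++ q.encode).map .inl ∧ o = (LPath.union p q).ops.reverse ∧ t = [] := by
  obtain _ | ⟨⟨⟩, _ | ⟨⟨p⟩, _ | ⟨⟨⟩, _ | ⟨⟨q⟩, _ | ⟨⟨⟩, ⟨⟩⟩⟩⟩⟩⟩ := h
  exact ⟨p, q, by simp, by simp [LPath.ops], rfl⟩

theorem Phrases.alternatives (p q : LPath (List Bool)) : Phrases Pend.alternatives
    ((p.encode ++ q.encode).map .inl) (LPath.union p q).ops.reverse [] := by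
  have := Phrases.cons (.op (.combine or)) <| .cons (.path p) <| .cons (.op .swap) <|
    .cons (.path q) <| .cons (.op (.save false)) .nil
  simpa [LPath.ops, Pend.alternatives] using this

theorem Phrase.of_ofPath {i : Tok} {l : List Pend} {u : List (Tok ⊕ Cert)} {o : List Op}
    {t : List TapeSym} (h : Pend.ofPath i = some l) (hl : Phrases l u o t) :
    ∃ p : LPath (List Bool), .inl i :: u = p.encode.map .inl ∧ o = p.ops.reverse ∧ t = [] := by
  unfold Pend.ofPath at h
  split at h
  · obtain rfl := Option.some.inj h
    obtain _ | ⟨⟨p⟩, _ | ⟨⟨q⟩, ⟨⟩⟩⟩ := hl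
    exact ⟨.seq p q, by simp [LPath.encode], by simp [LPath.ops], rfl⟩
  · obtain rfl := Option.some.inj h
    obtain ⟨p, q, rfl, rfl, rfl⟩ := hl.of_alternatives
    exact ⟨.union p q, by simp [LPath.encode], rfl, rfl⟩
  · obtain ⟨s, hs⟩ := of_ofStep h hl
    exact ⟨.step s, hs⟩

theorem Phrase.of_ofFilt {i : Tok} {l : List Pend} {u : List (Tok ⊕ Cert)} {o : List Op}
    {t : List TapeSym} (h : Pend.ofFilt i = some l) (hl : Phrases l u o t) :
    ∃ e : FExpr (List Bool), .inl i :: u = e.encode.map .inl ∧ o = e.ops.reverse ∧ t = [] := by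
  unfold Pend.ofFilt at h
  split at h
  · obtain rfl := Option.some.inj h
    obtain ⟨p, q, rfl, rfl, rfl⟩ := hl.of_alternatives
    exact ⟨.or p q, by simp [FExpr.encode], rfl, rfl⟩
  · obtain ⟨p, hp⟩ := of_ofPath h hl
    exact ⟨.path p, hp⟩

theorem Phrase.of_expand {X : Pend} {i : Tok ⊕ Cert} {l : List Pend} {u : List (Tok ⊕ Cert)}
    {o : List Op} {t : List TapeSym} (h : X.expand i = some l) (hl : Phrases l u o t) :
    Phrase X (i :: u) o t := by
  unfold Pend.expand at h
  split at h
  · obtain ⟨p, h₁, rfl, rfl⟩ := of_ofPath h hl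
    exact h₁ ▸ .path p
  · obtain ⟨p, h₁, rfl, rfl⟩ := of_ofStep h hl
    exact h₁ ▸ .step p
  · obtain ⟨p, h₁, rfl, rfl⟩ := of_ofFilt h hl
    exact h₁ ▸ .filt p
  all_goals first | cases h; done | obtain rfl := Option.some.inj h
  · obtain ⟨⟩ := hl
    exact .test .wildcard
  · obtain _ | ⟨⟨⟩, _ | ⟨⟨⟩, _ | ⟨⟨⟩, ⟨⟩⟩⟩⟩ := hl
    rename_i a
    simpa [NodeTest.encode, NodeTest.ops] using Phrase.test (.label (_ :: a))
  · obtain _ | ⟨⟨⟩, ⟨⟩⟩ := hl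
    exact .test (.label [])
  · obtain _ | ⟨⟨⟩, _ | ⟨⟨⟩, ⟨⟩⟩⟩ := hl
    rename_i a
    simpa using Phrase.bits (_ :: a)
  · obtain ⟨⟩ := hl
    exact .bits []
  · obtain _ | ⟨⟨⟩, _ | ⟨⟨⟩, ⟨⟩⟩⟩ := hl
    rename_i a k
    simpa [Forest.cert, Forest.tape] using Phrase.tree (_ :: a) k
  · obtain _ | ⟨⟨⟩, _ | ⟨⟨⟩, ⟨⟩⟩⟩ := hl
    rename_i k
    simpa [Forest.cert, Forest.tape] using Phrase.tree [] k
  · obtain _ | ⟨⟨⟩, _ | ⟨⟨⟩, _ | ⟨⟨⟩, ⟨⟩⟩⟩⟩ := hl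
    rename_i a k s
    simpa [Forest.cert, Forest.tape] using Phrase.kids (.cons (_ :: a) k s)
  · obtain _ | ⟨⟨⟩, _ | ⟨⟨⟩, _ | ⟨⟨⟩, ⟨⟩⟩⟩⟩ := hl
    rename_i k s
    simpa [Forest.cert, Forest.tape] using Phrase.kids (.cons [] k s)
  · obtain _ | ⟨⟨⟩, ⟨⟩⟩ := hl
    exact .kids .nil

theorem LStep.exists_ofStep (s : LStep (List Bool)) : ∃ i l u, s.encode.map .inl = .inl i :: u ∧
    Pend.ofStep i = some l ∧ Phrases l u s.ops.reverse [] := by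
  rcases s with ⟨_ | _ | _, n⟩ | ⟨s, e⟩
  · refine ⟨_, _, n.encode.map .inl, rfl, rfl, ?_⟩
    simpa [LStep.ops, Axis.ops] using Phrases.singleton (.test n)
  · refine ⟨_, _, n.encode.map .inl, rfl, rfl, ?_⟩
    simpa [LStep.ops, Axis.ops] using
      Phrases.cons (.op (.axis false)) (.singleton (.test n))
  · refine ⟨_, _, n.encode.map .inl, rfl, rfl, ?_⟩
    simpa [LStep.ops, Axis.ops] using
      Phrases.cons (.op (.axis true)) (.singleton (.test n))
  · refine ⟨_, _, (s.encode ++ e.encode).map .inl, rfl, rfl, ?_⟩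
    have := Phrases.cons (.step s) <| .cons (.op (.combine and)) <| .cons (.filt e) <|
      .singleton (.op (.save true))
    simpa [LStep.ops] using this

theorem LPath.exists_ofPath (p : LPath (List Bool)) : ∃ i l u, p.encode.map .inl = .inl i :: u ∧
    Pend.ofPath i = some l ∧ Phrases l u p.ops.reverse [] := by
  rcases p with s | ⟨p, q⟩ | ⟨p, q⟩
  · obtain ⟨i, l, u, h₁, h₂, h₃⟩ := s.exists_ofStep
    exact ⟨i, l, u, h₁, Pend.ofPath_of_ofStep h₂, h₃⟩
  · refine ⟨_, _, (p.encode ++ q.encode).map .inl, rfl, rfl, ?_⟩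
    simpa [LPath.ops] using Phrases.cons (.path p) (.singleton (.path q))
  · exact ⟨_, _, (p.encode ++ q.encode).map .inl, rfl, rfl, .alternatives p q⟩

theorem FExpr.exists_ofFilt (e : FExpr (List Bool)) : ∃ i l u, e.encode.map .inl = .inl i :: u ∧
    Pend.ofFilt i = some l ∧ Phrases l u e.ops.reverse [] := by
  rcases e with p | ⟨p, q⟩
  · obtain ⟨i, l, u, h₁, h₂, h₃⟩ := p.exists_ofPath
    exact ⟨i, l, u, h₁, Pend.ofFilt_of_ofPath h₂, h₃⟩
  · exact ⟨_, _, (p.encode ++ q.encode).map .inl, rfl, rfl, .alternatives p q⟩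

/-- The symbols that the parser writes without reading. -/
def Pend.IsOutput : Pend → Prop
  | .op _ => True
  | .tape _ => True
  | _ => False

theorem Phrase.exists_expand {X : Pend} {u : List (Tok ⊕ Cert)} {o : List Op}
    {t : List TapeSym} (h : Phrase X u o t) (hX : ¬ X.IsOutput) :
    ∃ i l u', u = i :: u' ∧ X.expand i = some l ∧ Phrases l u' o t := by
  cases h with
  | path p =>
    obtain ⟨i, l, u, h₁, h₂, h₃⟩ := p.exists_ofPath
    exact ⟨_, l, u, h₁, h₂, h₃⟩
  | step s =>
    obtain ⟨i, l, u, h₁, h₂, h₃⟩ := s.exists_ofStep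
    exact ⟨_, l, u, h₁, h₂, h₃⟩
  | filt e =>
    obtain ⟨i, l, u, h₁, h₂, h₃⟩ := e.exists_ofFilt
    exact ⟨_, l, u, h₁, h₂, h₃⟩
  | test n =>
    rcases n with _ | (_ | ⟨b, a⟩)
    · exact ⟨_, _, _, rfl, rfl, .nil⟩
    · exact ⟨_, _, _, rfl, rfl, .singleton (.op .test)⟩
    · refine ⟨_, _, _, rfl, rfl, ?_⟩
      have := Phrases.cons (.op .test) <| .cons (.op (.bit b)) <| .singleton (.bits a)
      simpa [NodeTest.ops] using this
  | bits a =>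
    rcases a with _ | ⟨b, a⟩
    · exact ⟨_, _, _, rfl, rfl, .nil⟩
    · exact ⟨_, _, _, rfl, rfl, .cons (.op (.bit b)) (.singleton (.bits a))⟩
  | tree a k =>
    rcases a with _ | ⟨b, a⟩
    · refine ⟨_, _, _, rfl, rfl, ?_⟩
      simpa [Forest.cert, Forest.tape] using
        Phrases.cons (.tape (.node true)) (.singleton (.kids k))
    · refine ⟨_, _, _, rfl, rfl, ?_⟩
      simpa [Forest.cert, Forest.tape] using
        Phrases.cons (.tape (.bit b)) (.singleton (.tree a k))
  | kids k =>
    rcases k with _ | ⟨_ | ⟨b, a⟩, k, s⟩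
    · exact ⟨_, _, _, rfl, rfl, .singleton (.tape .close)⟩
    · refine ⟨_, _, _, rfl, rfl, ?_⟩
      simpa [Forest.cert, Forest.tape] using
        Phrases.cons (.tape (.node true)) (.cons (.kids k) (.singleton (.kids s)))
    · refine ⟨_, _, _, rfl, rfl, ?_⟩
      simpa [Forest.cert, Forest.tape] using
        Phrases.cons (.tape (.bit b)) (.cons (.tree a k) (.singleton (.kids s)))
  | op o => exact absurd trivial hX
  | tape x => exact absurd trivial hX

theorem Phrases.cons_of_expand {X : Pend} {i : Tok ⊕ Cert} {l l' : List Pend}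
    {u : List (Tok ⊕ Cert)} {o : List Op} {t : List TapeSym} (h : X.expand i = some l')
    (hu : Phrases (l' ++ l) u o t) : Phrases (X :: l) (i :: u) o t := by
  obtain ⟨_, _, _, _, _, _, rfl, rfl, rfl, h₁, h₂⟩ := append_iff.1 hu
  exact .cons (.of_expand h h₁) h₂

theorem Phrases.exists_expand {X : Pend} {l : List Pend} {u : List (Tok ⊕ Cert)} {o : List Op}
    {t : List TapeSym} (h : Phrases (X :: l) u o t) (hX : ¬ X.IsOutput) :
    ∃ i l' u', u = i :: u' ∧ X.expand i = some l' ∧ Phrases (l' ++ l) u' o t := by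
  obtain _ | ⟨h₁, h₂⟩ := h
  obtain ⟨i, l', u', rfl, h₃, h₄⟩ := h₁.exists_expand hX
  exact ⟨i, l', _, rfl, h₃, append_iff.2 ⟨_, _, _, _, _, _, rfl, rfl, rfl, h₄, h₂⟩⟩

namespace Prog

open Cmd

/-- The step of the parser for a symbol. -/
def parse : Pend → Prog
  | .op o => push .code o
  | .tape x => push .back x
  | X => pop .inp fun i => match i.bind X.expand with
    | none => seq (push .flag true) (drain .pend)
    | some l => pushAll l

theorem parse_of_not_isOutput {X : Pend} (hX : ¬ X.IsOutput) :
    parse X = pop .inp fun i => match i.bind X.expand with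
      | none => seq (push .flag true) (drain .pend)
      | some l => pushAll l := by
  cases X <;> first | rfl | exact absurd trivial hX

theorem pushAll_spec (l : List Pend) (s : Store) :
    Ex (pushAll l) s {s with pend := l ++ s.pend} (l.length + 1) := by
  induction l with
  | nil => exact Ex.skip
  | cons x l ih => exact ih.seq Ex.push

/-- Either a prefix of the input is parsed, or there is no such prefix and the flag is raised. -/
theorem loop_parse (N : ℕ) : ∀ {pend inp code back}, 6 * inp.length + pend.length ≤ N →
    (∃ u r o t, inp = u ++ r ∧ Phrases pend u o t ∧ r.length + o.length + t.length ≤ N ∧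
      Ex (loop .pend parse) {inp := inp, pend := pend, code := code, back := back}
        {inp := r, code := o.reverse ++ code, back := t.reverse ++ back} (14 * N + 1)) ∨
    (¬ ∃ u r o t, inp = u ++ r ∧ Phrases pend u o t) ∧
      ∃ r c b, r.length + c.length + b.length ≤ N + code.length + back.length ∧
        Ex (loop .pend parse) {inp := inp, pend := pend, code := code, back := back}
          {inp := r, code := c, back := b, flag := [true]} (14 * N + 1) := by
  induction N with
  | zero =>
    intro pend inp code back hN
    obtain rfl : inp = [] := List.length_eq_zero_iff.1 (by omega)
    obtain rfl : pend = [] := List.length_eq_zero_iff.1 (by simpa using hN)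
    exact .inl ⟨[], [], [], [], rfl, .nil, le_rfl, Ex.loop_nil rfl⟩
  | succ N ih =>
    intro pend inp code back hN
    rcases pend with _ | ⟨X, pend⟩
    · exact .inl ⟨[], inp, [], [], rfl, .nil, by simp at hN ⊢; omega,
        (Ex.loop_nil rfl).mono (by omega)⟩
    rw [List.length_cons] at hN
    by_cases hX : X.IsOutput
    · cases X with
      | op x =>
        rcases ih (pend := pend) (inp := inp) (code := x :: code) (back := back) (by omega) with
          ⟨u, r, o, t, rfl, h₁, h₂, h₃⟩ | ⟨h₁, r, c, b, h₂, h₃⟩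
        · refine .inl ⟨u, r, x :: o, t, rfl, .cons (.op x) h₁,
            by simp only [List.length_cons]; omega,
            Ex.loop_cons rfl Ex.push (n := 14 * N + 1) ?_ (by omega)⟩
          rw [List.reverse_cons, List.append_assoc]
          exact h₃
        · refine .inr ⟨?_, r, c, b, by simp only [List.length_cons] at h₂; omega,
            Ex.loop_cons rfl Ex.push h₃ (by omega)⟩
          rintro ⟨u, r, o, t, rfl, h⟩
          obtain _ | ⟨⟨⟩, h⟩ := h
          exact h₁ ⟨_, _, _, _, rfl, h⟩
      | tape x =>
        rcases ih (pend := pend) (inp := inp) (code := code) (back := x :: back) (by omega) with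
          ⟨u, r, o, t, rfl, h₁, h₂, h₃⟩ | ⟨h₁, r, c, b, h₂, h₃⟩
        · refine .inl ⟨u, r, o, x :: t, rfl, .cons (.tape x) h₁,
            by simp only [List.length_cons]; omega,
            Ex.loop_cons rfl Ex.push (n := 14 * N + 1) ?_ (by omega)⟩
          rw [List.reverse_cons, List.append_assoc]
          exact h₃
        · refine .inr ⟨?_, r, c, b, by simp only [List.length_cons] at h₂; omega,
            Ex.loop_cons rfl Ex.push h₃ (by omega)⟩
          rintro ⟨u, r, o, t, rfl, h⟩
          obtain _ | ⟨⟨⟩, h⟩ := h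
          exact h₁ ⟨_, _, _, _, rfl, h⟩
      | _ => exact hX.elim
    cases hl : inp.head?.bind X.expand with
    | none =>
      refine .inr ⟨?_, inp.tail, code, back, by simp only [List.length_tail]; omega, ?_⟩
      · rintro ⟨u, r, o, t, rfl, h⟩
        obtain ⟨i, l', u', rfl, h₃, -⟩ := h.exists_expand hX
        simp [h₃] at hl
      · refine Ex.loop_cons rfl
          (s' := {inp := inp.tail, code := code, back := back, flag := [true]})
          (m := 1 + (2 * pend.length + 1) + 1) (n := 1) ?_ (Ex.loop_nil rfl) (by omega)
        rw [parse_of_not_isOutput hX]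
        refine Ex.pop ?_
        simp only [Store.get, Store.set, hl]
        exact Ex.seq Ex.push (Ex.drain (k := .pend) (fun _ => rfl)
          {inp := inp.tail, code := code, back := back, flag := [true]} pend)
    | some l =>
      obtain ⟨i, hi, hl'⟩ := Option.bind_eq_some_iff.1 hl
      obtain ⟨inp, rfl⟩ : ∃ inp', inp = i :: inp' := by
        cases inp <;> simp_all
      have hlen := Pend.length_le_of_expand hl'
      have hstep : Ex (parse X) {inp := i :: inp, pend := pend, code := code, back := back}
          {inp := inp, pend := l ++ pend, code := code, back := back} (l.length + 1 + 1) := by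
        rw [parse_of_not_isOutput hX]
        refine Ex.pop ?_
        simp only [Store.get, Store.set, hl]
        exact pushAll_spec l {inp := inp, pend := pend, code := code, back := back}
      rw [List.length_cons] at hN
      rcases ih (pend := l ++ pend) (inp := inp) (code := code) (back := back)
        (by rw [List.length_append]; omega) with
          ⟨u, r, o, t, rfl, h₁, h₂, h₃⟩ | ⟨h₁, r, c, b, h₂, h₃⟩
      · exact .inl ⟨i :: u, r, o, t, rfl, .cons_of_expand hl' h₁, by omega,
          Ex.loop_cons rfl hstep h₃ (by omega)⟩
      · refine .inr ⟨?_, r, c, b, by omega, Ex.loop_cons rfl hstep h₃ (by omega)⟩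
        rintro ⟨u, r, o, t, h, h'⟩
        obtain ⟨i', l', u', rfl, h₄, h₅⟩ := h'.exists_expand hX
        obtain ⟨rfl, rfl⟩ := List.cons.inj h
        obtain rfl := Option.some.inj (h₄.symm.trans hl')
        exact h₁ ⟨_, _, _, _, rfl, h₅⟩

end Prog

theorem Phrases.unique (N : ℕ) : ∀ {pend : List Pend} {u u' r r' : List (Tok ⊕ Cert)}
    {o o' : List Op} {t t' : List TapeSym}, 6 * u.length + pend.length ≤ N →
    Phrases pend u o t → Phrases pend u' o' t' → u ++ r = u' ++ r' → u = u' ∧ o = o' ∧ t = t' := by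
  induction N with
  | zero =>
    intro pend u u' r r' o o' t t' hN h h' _
    obtain rfl : pend = [] := List.length_eq_zero_iff.1 (by omega)
    cases h
    cases h'
    exact ⟨rfl, rfl, rfl⟩
  | succ N ih =>
    intro pend u u' r r' o o' t t' hN h h' he
    rcases pend with _ | ⟨X, pend⟩
    · cases h
      cases h'
      exact ⟨rfl, rfl, rfl⟩
    rw [List.length_cons] at hN
    by_cases hX : X.IsOutput
    · obtain _ | ⟨h₁, h₂⟩ := h
      obtain _ | ⟨h₁', h₂'⟩ := h'
      cases h₁ with
      | op x =>
        cases h₁'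
        obtain ⟨h₃, h₄, h₅⟩ := ih (by simp at hN; omega) h₂ h₂' he
        simp [h₃, h₄, h₅]
      | tape x =>
        cases h₁'
        obtain ⟨h₃, h₄, h₅⟩ := ih (by simp at hN; omega) h₂ h₂' he
        simp [h₃, h₄, h₅]
      | _ => exact hX.elim
    · obtain ⟨i, l, u, rfl, h₁, h₂⟩ := h.exists_expand hX
      obtain ⟨i', l', u', rfl, h₁', h₂'⟩ := h'.exists_expand hX
      obtain ⟨rfl, he'⟩ := List.cons.inj he
      obtain rfl := Option.some.inj (h₁.symm.trans h₁')
      have hlen := Pend.length_le_of_expand h₁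
      obtain ⟨h₃, h₄, h₅⟩ := ih (by simp at hN ⊢; omega) h₂ h₂' he'
      simp [h₃, h₄, h₅]

/-! ### The verifier -/

/-- The symbols from which the code of an instance is parsed. -/
def Pend.instance : List Pend := [.op (.combine fun a b => a && !b), .path, .op (.save true), .path]

theorem Phrases.instance (p q : LPath (List Bool)) : Phrases Pend.instance
    ((encodeInstance (p, q)).map .inl) (diffOps p q).reverse [] := by
  have := Phrases.cons (.op (.combine fun a b => a && !b)) <| .cons (.path p) <|
    .cons (.op (.save true)) <| .singleton (.path q)
  simpa [diffOps, Pend.instance, encodeInstance] using this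

theorem Phrases.of_instance {u : List (Tok ⊕ Cert)} {o : List Op} {t : List TapeSym}
    (h : Phrases Pend.instance u o t) : ∃ p q : LPath (List Bool),
      u = (encodeInstance (p, q)).map .inl ∧ o = (diffOps p q).reverse ∧ t = [] := by
  obtain _ | ⟨⟨⟩, _ | ⟨⟨p⟩, _ | ⟨⟨⟩, _ | ⟨⟨q⟩, ⟨⟩⟩⟩⟩⟩ := h
  exact ⟨p, q, by simp [encodeInstance], by simp [diffOps], rfl⟩

theorem Phrases.of_tree {u : List (Tok ⊕ Cert)} {o : List Op} {t : List TapeSym}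
    (h : Phrases [.tree] u o t) : ∃ a k, u = (Forest.cons a k .nil).cert.map .inr ∧ o = [] ∧
      t = (Forest.cons a k .nil).tape fun _ => True := by
  obtain _ | ⟨⟨⟩, ⟨⟩⟩ := h
  rename_i a k
  exact ⟨a, k, by simp, rfl, by simp⟩

/-- `IsWitness w c`: the word `w` is the code of a pair of expressions, and `c` is a certificate
for it. -/
def IsWitness (w : List Tok) (c : List Cert) : Prop :=
  ∃ p q a k, w = encodeInstance (p, q) ∧ c = (Forest.cons a k .nil).cert ∧
    Node.Matches (a, k) p ∧ ¬ Node.Matches (a, k) q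

namespace Prog

open Cmd

def readMark : TapeSym → Prog
  | .node m => push .flag m
  | _ => skip

def evaluate : Prog :=
  seq (loop .code op) <| seq (loop .back readMark) <| pop .flag fun o => finish (o.getD false)

def readTree : Prog :=
  seq (push .pend .tree) <| seq (loop .pend parse) <| pop .flag fun
    | some _ => finish false
    | none => pop .inp fun
      | some _ => finish false
      | none => evaluate

/-- The verifier.  It accepts a word that is not the code of an instance with every certificate. -/
def verify : Prog :=
  seq (pushAll Pend.instance) <| seq (loop .pend parse) <| pop .flag fun
    | some _ => finish true
    | none => pop .inp fun
      | some (.inl _) => finish true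
      | some (.inr d) => seq (push .inp (.inr d)) readTree
      | none => readTree

theorem finish_spec (b : Bool) (i : List (Tok ⊕ Cert)) (c : List Op) (ba : List TapeSym)
    (fl : List Bool) :
    Ex (finish b) {inp := i, code := c, back := ba, flag := fl} {out := [b]}
      (2 * (i.length + c.length + ba.length + fl.length) + 11) := by
  have d {k : Stk} (s : Store) (l : List k.Sym) := Ex.drain (k := k) (f := fun _ => skip)
    (fun _ => rfl) s l
  have := (d (k := .inp) {code := c, back := ba, flag := fl} i).seq <|
    (d (k := .pend) {code := c, back := ba, flag := fl} []).seq <|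
    (d (k := .code) {back := ba, flag := fl} c).seq <|
    (d (k := .front) {back := ba, flag := fl} []).seq <|
    (d (k := .back) {flag := fl} ba).seq <|
    (d (k := .acc) {flag := fl} []).seq <|
    (d (k := .saved) {flag := fl} []).seq <|
    (d (k := .lb) {flag := fl} []).seq <|
    (d (k := .lb') {flag := fl} []).seq <|
    (d (k := .flag) {} fl).seq <| Ex.push (k := .out) (a := b)
  exact this.mono (by simp only [List.length_nil]; omega)

def mark : TapeSym → Option Bool
  | .node m => some m
  | _ => none

theorem loop_readMark (l : List TapeSym) : ∀ {fl : List Bool},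
    Ex (loop .back readMark) {back := l, flag := fl}
      {flag := (l.filterMap mark).reverse ++ fl} (2 * l.length + 1) := by
  induction l with
  | nil => exact Ex.loop_nil rfl
  | cons x l ih =>
    intro fl
    cases x with
    | node m =>
      refine Ex.loop_cons (m := 1) (s' := {back := l, flag := m :: fl}) rfl Ex.push
        (n := 2 * l.length + 1) ?_ (by simp only [List.length_cons]; omega)
      simpa [mark, List.filterMap_cons] using ih (fl := m :: fl)
    | _ =>
      refine Ex.loop_cons (m := 1) (s' := {back := l, flag := fl}) rfl Ex.skip
        (n := 2 * l.length + 1) ?_ (by simp only [List.length_cons]; omega)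
      simpa [mark, List.filterMap_cons] using ih (fl := fl)

theorem evaluate_spec (p q : LPath (List Bool)) (a : List Bool) (k : Forest (List Bool)) {N : ℕ}
    (hN : 20 * ((Forest.cons a k .nil).tapeLen + 1) * (diffOps p q).length +
      4 * (Forest.cons a k .nil).tapeLen + 20 ≤ N) :
    Ex evaluate {code := diffOps p q, back := ((Forest.cons a k .nil).tape fun _ => True).reverse}
      {out := [@decide (Node.Matches (a, k) p ∧ ¬ Node.Matches (a, k) q)
        (Classical.propDecidable _)]} N := by
  set f := Forest.cons a k .nil with hf
  set X : Node (List Bool) → Prop := fun u => u.Matches p ∧ ¬ u.Matches q with hX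
  have h₁ := loop_diff (f := f) p q (Ex.loop_nil (k := .code) rfl) le_rfl
  have h₂ := loop_readMark (f.tape X).reverse (fl := [])
  rw [List.filterMap_reverse, List.reverse_reverse, List.append_nil, List.length_reverse] at h₂
  obtain ⟨l, hl⟩ : ∃ l, (f.tape X).filterMap mark =
      @decide (X (a, k)) (Classical.propDecidable _) :: l := by
    have ha : (a.map TapeSym.bit).filterMap mark = [] := by
      rw [List.filterMap_map]
      exact List.filterMap_eq_nil_iff.2 fun _ _ => rfl
    refine ⟨(k.tape X ++ [TapeSym.close]).filterMap mark, ?_⟩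
    change (a.map TapeSym.bit ++ TapeSym.node (@decide (X (a, k)) (Classical.propDecidable _)) ::
      (k.tape X ++ [TapeSym.close])).filterMap mark = _
    rw [List.filterMap_append, ha]
    rfl
  have hlen : l.length + 1 ≤ (f.tape X).length := by
    have := List.length_filterMap_le mark (f.tape X)
    rwa [hl] at this
  rw [hl] at h₂
  have h₃ := finish_spec (@decide (X (a, k)) (Classical.propDecidable _)) [] [] [] l
  have := f.length_tape_eq X
  refine (h₁.seq (h₂.seq (Ex.pop h₃))).mono ?_
  simp only [List.length_nil]
  omega

theorem readTree_spec (p q : LPath (List Bool)) (c : List Cert) {N : ℕ}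
    (hN : 20 * (6 * c.length + 2) * (diffOps p q).length + 100 * (6 * c.length + 1) +
      2 * (diffOps p q).length + 100 ≤ N) :
    ∃ b, Ex readTree {inp := c.map .inr, code := diffOps p q} {out := [b]} N ∧
      (b = true ↔ IsWitness (encodeInstance (p, q)) c) := by
  rcases loop_parse (6 * c.length + 1) (pend := [.tree]) (inp := c.map .inr)
    (code := diffOps p q) (back := []) (by simp) with
    ⟨u, r, o, t, h₁, h₂, h₃, h₄⟩ | ⟨h₁, r, c', b, h₂, h₃⟩
  · obtain ⟨a, k, rfl, rfl, rfl⟩ := h₂.of_tree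
    have key : ∀ {a' k' r'}, c.map .inr = (Forest.cons a' k' .nil).cert.map .inr ++ r' →
        r = r' ∧ (Forest.cons a k .nil).tape (fun _ => True) =
          (Forest.cons a' k' .nil).tape (fun _ => True) := by
      intro a' k' r' h
      have h₅ := h₁.symm.trans h
      obtain ⟨h₆, -, h₇⟩ := Phrases.unique _ le_rfl h₂ (.singleton (.tree a' k')) h₅
      rw [h₆] at h₅
      exact ⟨List.append_cancel_left h₅, h₇⟩
    rcases r with _ | ⟨i, r⟩
    · obtain ⟨a', k', hc, hw⟩ : ∃ a' k', c = (Forest.cons a' k' .nil).cert ∧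
          (IsWitness (encodeInstance (p, q)) c ↔
            Node.Matches (a', k') p ∧ ¬ Node.Matches (a', k') q) := by
        by_cases h : IsWitness (encodeInstance (p, q)) c
        · obtain ⟨p', q', a', k', hpq, hc, hp, hq⟩ := h
          obtain ⟨rfl, rfl⟩ := Prod.mk.inj (encodeInstance_injective hpq)
          exact ⟨a', k', hc, iff_of_true ⟨p, q, a', k', rfl, hc, hp, hq⟩ ⟨hp, hq⟩⟩
        · have hc : c = (Forest.cons a k .nil).cert := by
            rw [List.append_nil] at h₁
            exact List.map_injective_iff.2 Sum.inr_injective h₁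
          exact ⟨a, k, hc, iff_of_false h fun hpq => h ⟨p, q, a, k, rfl, hc, hpq⟩⟩
      rw [(key (r' := []) (by rw [hc, List.append_nil])).2] at h₃ h₄
      have ht : (Forest.cons a' k' .nil).tapeLen ≤ 6 * c.length + 1 :=
        (Nat.le_add_left _ _).trans h₃
      rw [List.append_nil] at h₄
      have h₅ := evaluate_spec p q a' k' le_rfl
      refine ⟨_, (Ex.seq Ex.push (h₄.seq (Ex.pop (Ex.pop h₅)))).mono ?_, ?_⟩
      · have := Nat.mul_le_mul_right (diffOps p q).length (show
          20 * ((Forest.cons a' k' .nil).tapeLen + 1) ≤ 20 * (6 * c.length + 2) by omega)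
        omega
      · rw [hw]
        exact @decide_eq_true_iff _ (Classical.propDecidable _)
    · rw [List.append_nil] at h₄
      have h₅ := finish_spec false r (diffOps p q)
        ((Forest.cons a k .nil).tape fun _ => True).reverse []
      refine ⟨false, (Ex.seq Ex.push (h₄.seq (Ex.pop (Ex.pop h₅)))).mono ?_,
        iff_of_false (by simp) ?_⟩
      · simp only [List.length_cons, List.length_reverse, List.length_nil] at h₃ ⊢
        nlinarith
      · rintro ⟨p', q', a', k', hpq, hc, hp, hq⟩
        simpa using (key (r' := []) (by rw [hc, List.append_nil])).1
  · refine ⟨false, (Ex.seq Ex.push (h₃.seq (Ex.pop (finish_spec false r c' b [])))).mono ?_,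
      iff_of_false (by simp) ?_⟩
    · simp only [List.length_nil] at h₂ ⊢
      nlinarith
    · rintro ⟨p', q', a', k', hpq, hc, hp, hq⟩
      exact h₁ ⟨_, [], _, _, by rw [hc, List.append_nil], .singleton (.tree a' k')⟩

theorem eq_of_map_append_eq {c : List Cert} : ∀ {w x : List Tok} {r : List (Tok ⊕ Cert)},
    w.map .inl ++ c.map .inr = x.map .inl ++ r → (∀ i r', r ≠ .inl i :: r') →
    w = x ∧ r = c.map .inr
  | [], [], _, h, _ => ⟨rfl, h.symm⟩
  | [], _ :: _, _, h, _ => by cases c <;> simp at h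
  | i :: w, [], _, h, hr => absurd h.symm (hr _ _)
  | i :: w, j :: x, _, h, hr => by
    simp only [List.map_cons, List.cons_append, List.cons.injEq, Sum.inl.injEq] at h
    obtain ⟨h₁, h₂⟩ := eq_of_map_append_eq h.2 hr
    exact ⟨by rw [h.1, h₁], h₂⟩

theorem verify_spec (w : List Tok) (c : List Cert) :
    ∃ b, Ex verify {inp := w.map .inl ++ c.map .inr} {out := [b]}
      (2000 * (w.length + c.length + 1) ^ 2) ∧
      (b = true ↔ (∀ x, w ≠ encodeInstance x) ∨ IsWitness w c) := by
  set M := w.length + c.length with hM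
  have h₀ := pushAll_spec Pend.instance {inp := w.map .inl ++ c.map .inr}
  have hlen : Pend.instance.length = 4 := rfl
  rw [List.append_nil, hlen] at h₀
  rcases loop_parse (6 * M + 4) (pend := Pend.instance) (inp := w.map .inl ++ c.map .inr)
    (code := []) (back := []) (by simp [hM, hlen]) with
    ⟨u, r, o, t, h₁, h₂, h₃, h₄⟩ | ⟨h₁, r, c', b, h₂, h₃⟩
  · obtain ⟨p, q, rfl, rfl, rfl⟩ := h₂.of_instance
    rw [List.reverse_reverse, List.append_nil] at h₄
    rw [List.length_reverse] at h₃
    have key : (∀ i r', r ≠ .inl i :: r') → ∃ b, Ex readTree {inp := r, code := diffOps p q}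
        {out := [b]} (1500 * (M + 1) ^ 2) ∧
        (b = true ↔ (∀ x, w ≠ encodeInstance x) ∨ IsWitness w c) := by
      intro hr
      obtain ⟨rfl, rfl⟩ := eq_of_map_append_eq h₁ hr
      obtain ⟨b, hb, hb'⟩ := readTree_spec p q c (N := 1500 * (M + 1) ^ 2) (by
        have : (diffOps p q).length ≤ 6 * (M + 1) := by omega
        have h5 : 20 * (6 * c.length + 2) * (diffOps p q).length ≤
            20 * (6 * (M + 1)) * (6 * (M + 1)) := Nat.mul_le_mul (by omega) this
        nlinarith)
      exact ⟨b, hb, hb'.trans (or_iff_right fun h => h _ rfl).symm⟩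
    rcases r with _ | ⟨i | d, r⟩
    · obtain ⟨b, hb, hb'⟩ := key (by simp)
      exact ⟨b, (h₀.seq (h₄.seq (Ex.pop (Ex.pop hb)))).mono (by nlinarith), hb'⟩
    · have h₅ := finish_spec true r (diffOps p q) [] []
      refine ⟨true, (h₀.seq (h₄.seq (Ex.pop (Ex.pop h₅)))).mono ?_,
        iff_of_true rfl (.inl ?_)⟩
      · simp only [List.length_cons, List.length_nil] at h₃ ⊢
        nlinarith
      · rintro ⟨p', q'⟩ rfl
        obtain ⟨h₅, -⟩ := Phrases.unique _ le_rfl h₂ (.instance p' q') h₁.symm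
        rw [h₅] at h₁
        have := List.append_cancel_left h₁
        cases c <;> simp at this
    · obtain ⟨b, hb, hb'⟩ := key (by simp)
      exact ⟨b, (h₀.seq (h₄.seq (Ex.pop (Ex.pop (Ex.seq Ex.push hb))))).mono (by nlinarith), hb'⟩
  · refine ⟨true, (h₀.seq (h₃.seq (Ex.pop (finish_spec true r c' b [])))).mono ?_,
      iff_of_true rfl (.inl ?_)⟩
    · simp only [List.length_nil] at h₂ ⊢
      nlinarith
    · rintro ⟨p', q'⟩ rfl
      exact h₁ ⟨_, _, _, _, rfl, .instance p' q'⟩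

end Prog

/-! ### The containment problem is in coNP -/

mutual

theorem LPath.size_le_length_encode : ∀ (p : LPath (List Bool)) {d : LPath (List Bool)},
    d ∈ p.dnf → d.size ≤ p.encode.length
  | .step s, d, h => by
    obtain ⟨d, hd, rfl⟩ := List.mem_map.1 h
    exact s.size_le_length_encode hd
  | .seq p q, d, h => by
    obtain ⟨p', hp, h⟩ := List.mem_flatMap.1 h
    obtain ⟨q', hq, rfl⟩ := List.mem_map.1 h
    have := p.size_le_length_encode hp
    have := q.size_le_length_encode hq
    simp only [LPath.size, LPath.encode, List.length_cons, List.length_append]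
    omega
  | .union p q, d, h => by
    simp only [LPath.encode, List.length_cons, List.length_append]
    rcases List.mem_append.1 h with h | h
    · have := p.size_le_length_encode h
      omega
    · have := q.size_le_length_encode h
      omega

theorem LStep.size_le_length_encode : ∀ (s : LStep (List Bool)) {d : LStep (List Bool)},
    d ∈ s.dnf → d.size ≤ s.encode.length
  | .base a n, d, h => by
    obtain rfl := List.mem_singleton.1 h
    cases a <;> simp [LStep.size, LStep.encode, Axis.size, Axis.encode]
  | .filter s e, d, h => by
    obtain ⟨s', hs, h⟩ := List.mem_flatMap.1 h
    obtain ⟨e', he, rfl⟩ := List.mem_map.1 h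
    have := s.size_le_length_encode hs
    have := e.size_le_length_encode he
    simp only [LStep.size, LStep.encode, List.length_cons, List.length_append]
    omega

theorem FExpr.size_le_length_encode : ∀ (e : FExpr (List Bool)) {d : FExpr (List Bool)},
    d ∈ e.dnf → d.size ≤ e.encode.length
  | .path p, d, h => by
    obtain ⟨d, hd, rfl⟩ := List.mem_map.1 h
    exact p.size_le_length_encode hd
  | .or p q, d, h => by
    obtain ⟨d, hd, rfl⟩ := List.mem_map.1 h
    simp only [FExpr.size, FExpr.encode, List.length_cons, List.length_append]
    rcases List.mem_append.1 hd with h | h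
    · have := p.size_le_length_encode h
      omega
    · have := q.size_le_length_encode h
      omega

end

mutual

theorem LPath.length_label_le : ∀ (p : LPath (List Bool)) {a : List Bool}, a ∈ p.labels →
    a.length ≤ p.encode.length
  | .step s, _, h => s.length_label_le h
  | .seq p q, _, h => by
    simp only [LPath.encode, List.length_cons, List.length_append]
    rcases h with h | h
    · have := p.length_label_le h
      omega
    · have := q.length_label_le h
      omega
  | .union p q, _, h => by
    simp only [LPath.encode, List.length_cons, List.length_append]
    rcases h with h | h
    · have := p.length_label_le h
      omega
    · have := q.length_label_le h
      omega

theorem LStep.length_label_le : ∀ (s : LStep (List Bool)) {a : List Bool}, a ∈ s.labels →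
    a.length ≤ s.encode.length
  | .base _ n, _, h => by
    cases n with
    | wildcard => exact h.elim
    | label a =>
      obtain rfl := h
      simp only [LStep.encode, NodeTest.encode, List.length_append, List.length_map]
      omega
  | .filter s e, _, h => by
    simp only [LStep.encode, List.length_cons, List.length_append]
    rcases h with h | h
    · have := s.length_label_le h
      omega
    · have := e.length_label_le h
      omega

theorem FExpr.length_label_le : ∀ (e : FExpr (List Bool)) {a : List Bool}, a ∈ e.labels →
    a.length ≤ e.encode.length
  | .path p, _, h => p.length_label_le h
  | .or p q, _, h => by
    simp only [FExpr.encode, List.length_cons, List.length_append]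
    rcases h with h | h
    · have := p.length_label_le h
      omega
    · have := q.length_label_le h
      omega

end

theorem Forest.length_cert_le {L : ℕ} : ∀ f : Forest (List Bool), (∀ a ∈ f.labels, a.length ≤ L) →
    f.cert.length ≤ f.size * (L + 2)
  | .nil, _ => Nat.zero_le _
  | .cons a k s, h => by
    have h₁ := h a (by simp [Forest.labels])
    have h₂ := k.length_cert_le fun b hb => h b (by simp [Forest.labels, hb])
    have h₃ := s.length_cert_le fun b hb => h b (by simp [Forest.labels, hb])
    simp only [Forest.cert, Forest.size, List.length_append, List.length_cons, List.length_map]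
    nlinarith

theorem exists_isWitness {p q : LPath (List Bool)} (h : ¬ p.Contained q) {w : List Tok}
    (hw : w = encodeInstance (p, q)) : ∃ c, IsWitness w c ∧
      c.length ≤ (1 + w.length * (w.length + 2)) * (w.length + 3) := by
  have hlen : w.length = p.encode.length + q.encode.length := by
    rw [hw, encodeInstance, List.length_append]
  obtain ⟨⟨a, k⟩, h₁, h₂, hp, hq⟩ := exists_small_counterexample
    (fun d => p.size_le_length_encode) (fun d => q.size_le_length_encode)
    (e := List.replicate (w.length + 1) true)
    (fun he => by
      have := q.length_label_le he
      rw [List.length_replicate] at this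
      omega) h
  refine ⟨_, ⟨p, q, a, k, hw, rfl, hp, hq⟩, (Forest.length_cert_le (L := w.length + 1) _ ?_).trans
    (Nat.mul_le_mul_right _ ?_)⟩
  · intro b hb
    rcases h₂ (by simpa [Forest.labels] using hb) with hb | rfl
    · have := p.length_label_le hb
      omega
    · rw [List.length_replicate]
  · have h₃ : p.encode.length * (q.encode.length + 2) ≤ w.length * (w.length + 2) :=
      Nat.mul_le_mul (by omega) (by omega)
    simp only [Forest.size]
    simp only at h₁
    omega

theorem not_contained_of_isWitness {p q : LPath (List Bool)} {c : List Cert}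
    (h : IsWitness (encodeInstance (p, q)) c) : ¬ p.Contained q := by
  obtain ⟨p', q', a, k, hpq, -, hp, hq⟩ := h
  obtain ⟨rfl, rfl⟩ := Prod.mk.inj (encodeInstance_injective hpq)
  exact fun h => hq ((Node.matches_toTree _ _).1 (h _ ((Node.matches_toTree _ _).2 hp)))

theorem Store.get_empty_set (k : Stk) (l : List k.Sym) :
    (({} : Store).set k l).get = Function.update (fun _ => []) k l := by
  rw [Store.get_set]
  congr 1
  funext k
  cases k <;> rfl

theorem inCoNP_containmentProblem : InCoNP containmentProblem := by
  choose V hV using Prog.verify_spec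
  refine ⟨Cert, inferInstance, fun x => V x.1 x.2,
    (1 + .X * (.X + 2)) * (.X + 3), ⟨?_⟩, fun w => ?_⟩
  · refine
      { tm := Prog.verify.machine .inp .out
        inputAlphabet := Equiv.refl _
        outputAlphabet := Equiv.refl _
        time := 2000 * (.X + 1) ^ 2 + 1
        outputsFun := fun x => ?_ }
    have h := (hV x.1 x.2).1
    have h' := (Cmd.Exec.outputsInTime (c := Prog.verify) (inp := .inp) (out := .out)
      (l := x.1.map .inl ++ x.2.map .inr) (l' := [V x.1 x.2])
      (by rw [← Store.get_empty_set, ← Store.get_empty_set]; exact h)).some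
    have e : (2000 * (.X + 1) ^ 2 + 1 : Polynomial ℕ).eval
        (((Computability.encodingProd (Computability.encodingList Tok)
          (Computability.encodingList Cert)).encode x).length) =
        2000 * (x.1.length + x.2.length + 1) ^ 2 + 1 := by
      simp [Computability.encodingProd, Computability.encodingList]
    rw [e]
    have e' : List.map (Equiv.refl (Tok ⊕ Cert)).invFun
        ((Computability.encodingProd (Computability.encodingList Tok)
          (Computability.encodingList Cert)).encode x) = x.1.map .inl ++ x.2.map .inr :=
      List.map_id _
    exact e' ▸ h'
  · simp only [Polynomial.eval_mul, Polynomial.eval_add, Polynomial.eval_X, Polynomial.eval_one,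
      Polynomial.eval_ofNat]
    constructor
    · intro hw
      by_cases h : ∃ x, w = encodeInstance x
      · obtain ⟨⟨p, q⟩, hx⟩ := h
        obtain ⟨c, hc, hlen⟩ := exists_isWitness (fun h => hw ⟨p, q, hx, h⟩) hx
        exact ⟨c, hlen, (hV w c).2.2 (.inr hc)⟩
      · exact ⟨[], Nat.zero_le _, (hV w []).2.2 (.inl (not_exists.1 h))⟩
    · rintro ⟨c, -, hc⟩ ⟨p, q, rfl, h⟩
      rcases (hV _ c).2.1 hc with h' | h'
      · exact h' _ rfl
      · exact not_contained_of_isWitness h' h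

end XPathContainment

theorem theorem3p1 :
    XPathContainment.InCoNP XPathContainment.containmentProblem ∧
    ∀ {S : Type*} [Infinite S] (p q : XPathContainment.LPath S) (n m : ℕ),
      1 ≤ n → (∀ d ∈ p.dnf, d.size ≤ n) → (∀ d ∈ q.dnf, d.size ≤ m) →
      (∃ fresh : S, fresh ∉ p.labels ∪ q.labels) ∧
      ∀ fresh : S, fresh ∉ p.labels ∪ q.labels →
        (¬ p.Contained q ↔
          ∃ t : XPathContainment.XMLTree S,
            t.dom.card ≤ 2 * n * (m + 2) ∧
            (∀ v ∈ t.dom, t.lab v ∈ p.labels ∪ {fresh}) ∧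
            t.Matches p ∧ ¬ t.Matches q) :=
  ⟨XPathContainment.inCoNP_containmentProblem, fun p q _ _ hn hp hq =>
    ⟨(p.finite_labels.union q.finite_labels).exists_notMem,
      fun _ he => XPathContainment.not_contained_iff hn hp hq he⟩⟩
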